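/- **Theorem 4.3 (Weierstraß type representation).** *Setting.* Let $G=\mathrm{SL}(2,\mathbb R)$, $\mathfrak g=\mathfrak{sl}(2,\mathbb R)$, with $\langle X,Y\rangle=\tfrac12\operatorname{tr}(XY)$, and $$\mathbf i=\begin{pmatrix}0&-1\\1&0\end{pmatrix},\quad \mathbf j'=\begin{pmatrix}0&1\\1&0\end{pmatrix},\quad \mathbf k'=\begin{pmatrix}-1&0\\0&1\end{pmatrix}.$$ Put $S^2_1=\{X\in\mathfrak g:\langle X,X\rangle=1\}$, $\mathfrak k=\mathbb R\mathbf k'$, $\mathfrak m=\mathbb R\mathbf i\oplus\mathbb R\mathbf j'$ and $\sigma=\mathrm{Ad}(\mathbf k')$. Let $\Lambda\mathfrak g_\sigma$ be the Banach space of loops $\xi(\lambda)=\sum_{k\in\mathbb Z}\xi_k\lambda^k$, $\xi_k\in\mathfrak g$, with $\sum_k|\xi_k|<\infty$ and $\sigma(\xi(\lambda))=\xi(-\lambda)$. Let $\Lambda G_\sigma$ be the group of loops $\gamma=\sum_k\gamma_k\lambda^k$ with real $2\times2$ matrix coefficients, $\sum_k|\gamma_k|<\infty$, $\det\gamma(\lambda)=1$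 for $|\lambda|=1$ and $\sigma(\gamma(\lambda))=\gamma(-\lambda)$. The analytic twisted loop group $\tilde\Lambda G_\sigma$ consists of those $\gamma\in\Lambda G_\sigma$ that extend holomorphically to $\mathbb C^*$. Let $\Lambda^+G_\sigma$ be the subgroup of loops in $\Lambda G_\sigma$ with powers $k\ge0$ only, $\Lambda^-_*G_\sigma$ the subgroup of those with powers $k\le0$ only and $\gamma_0=\mathbf 1$, and let $\tilde\Lambda^+G_\sigma,\tilde\Lambda^-_*G_\sigma$ be their intersections with $\tilde\Lambda G_\sigma$. Smoothness of loop-valued maps refers to the norm $\sum_k|\gamma_k|$. Let $\mathbb D$ be a simply connected open subset of the Minkowski plane $(\mathbb R^2(x,y),dx\,dy)$ with $(0,0)\in\mathbb D$. For an open $U\subseteq\mathbb D$ containing the origin, an *extended framing* on $U$ is a smooth map $\Psi$ on $U$ with values in $\tilde\Lambda G_\sigma$, $\Psi(0,0)=\mathbf 1$, such that $$\Psi^{-1}d\Psi=(A+\lambda B)\,dx+(C+\lambda^{-1}E)\,dy$$ with smooth $A,C:U\to\mathfrak k$ and $B,E:U\to\mathfrak m$. A smooth map $\psi:U\to S^2_1$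 is *Lorentzian harmonic* if its tension field with respect to $dx\,dy$ and $\langle\cdot,\cdot\rangle$ vanishes. *Theorem.* Let $\xi'=\xi'_x\,dx$ be a smooth Lorentz-holomorphic 1-form on $\mathbb D$ (that is, $\partial_y\xi'_x=0$) with values in the loops of $\Lambda\mathfrak g_\sigma$ having powers $\lambda^k$, $k\le1$, only. Let $\xi''=\xi''_y\,dy$ be a smooth Lorentz-antiholomorphic 1-form on $\mathbb D$ ($\partial_x\xi''_y=0$) with values in the loops of $\Lambda\mathfrak g_\sigma$ having powers $k\ge-1$ only. 1. The problems $d\Psi'=\Psi'\xi'$, $\Psi'(0,0)=\mathbf 1$ and $d\Psi''=\Psi''\xi''$, $\Psi''(0,0)=\mathbf 1$ have unique solutions on $\mathbb D$. These are smooth with values in $\Lambda G_\sigma$. If the loops $\xi'_x(p)$ extend holomorphically to $\lambda\in\mathbb C^*$, jointly continuously in $(p,\lambda)$, then $\Psi'$ takes values in $\tilde\Lambda G_\sigma$; likewise for $\xi''$ and $\Psi''$. 2. There is a connected open neighbourhood $U\subseteq\mathbb D$ of the origin such that at each point of $U$ there is exactly one Iwasawa splitting $$(\Psi',\Psi'')=(\Psi,\Psi)\cdot(L_-^{-1},L_+^{-1}),\qquad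 \Psi\in\Lambda G_\sigma,\ L_-^{-1}\in\Lambda^-_*G_\sigma,\ L_+^{-1}\in\Lambda^+G_\sigma.$$ 3. On every connected open $U\subseteq\mathbb D$ which contains the origin and at each point of which such a splitting holds, $L_-^{-1}$ and $L_+^{-1}$ are smooth and $\Psi$ is an extended framing; in particular $\Psi$ takes values in $\tilde\Lambda G_\sigma$. For every $\lambda\in\mathbb R^+$, $\psi_\lambda=\mathrm{Ad}(\Psi_\lambda)\mathbf k'$ is a Lorentzian harmonic map from $U$ into $S^2_1$. At each point of $U$ where $\Psi'\in\tilde\Lambda G_\sigma$ one has $L_-^{-1}\in\tilde\Lambda^-_*G_\sigma$, and where $\Psi''\in\tilde\Lambda G_\sigma$ one has $L_+^{-1}\in\tilde\Lambda^+G_\sigma$; so if both hold, the splitting takes place in the analytic twisted loop group. -/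

import Mathlib

open scoped ContDiff Matrix.Norms.Operator

noncomputable section

namespace Timelike

/-! ### Minkowski three-space as `sl(2, ℝ)` and the pseudosphere -/

/-- Real `2 × 2` matrices; a point of Minkowski space is a trace-free matrix. -/
abbrev M2 := Matrix (Fin 2) (Fin 2) ℝ

def matI : M2 := !![0, -1; 1, 0]
def matJ : M2 := !![0, 1; 1, 0]
def matK : M2 := !![-1, 0; 0, 1]

/-- The Lorentzian scalar product `⟨X, Y⟩ = tr (X Y) / 2`; in the basis `matI, matJ, matK` of
`sl(2, ℝ)` it is `- u₁ v₁ + u₂ v₂ + u₃ v₃`. -/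
def scal (X Y : M2) : ℝ := (1 / 2) * (X * Y).trace

/-- The adjoint action `X ↦ g X g⁻¹`. -/
def Ad (g X : M2) : M2 := g * X * g⁻¹

/-- The unit pseudosphere of the Minkowski space `sl(2, ℝ)`. -/
def S21 : Set M2 := {X | X.trace = 0 ∧ scal X X = 1}

/-- `𝔨`, the Lie algebra of the isotropy group of `matK`. -/
def kPart : Submodule ℝ M2 := Submodule.span ℝ {matK}

/-- `𝔪`, the tangent space of the pseudosphere at `matK`. -/
def mPart : Submodule ℝ M2 := Submodule.span ℝ {matI, matJ}

/-- The involution `σ = Ad matK`, equal to `1` on `𝔨` and to `-1` on `𝔪`. -/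
def sigma (X : M2) : M2 := Ad matK X

/-! ### Lorentzian harmonic maps into the pseudosphere

The source is an open set of the Minkowski plane with null coordinates `(x, y)`. -/

/-- The coordinate vector fields `∂/∂x` and `∂/∂y`. -/
def coordVec : Fin 2 → ℝ × ℝ := ![(1, 0), (0, 1)]

/-- The Gram matrix of the metric `dx dy` in the coordinates `(x, y)`. -/
def planeMetric : Matrix (Fin 2) (Fin 2) ℝ := !![0, 1 / 2; 1 / 2, 0]

/-- Orthogonal projection of `X` to the tangent space of the pseudosphere at `N`. -/
def tangential (N X : M2) : M2 := X - scal X N • N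

/-- The second fundamental form `(∇dψ)(v, w)` of a map into the pseudosphere, for constant vector
fields `v, w`, which are parallel in the flat source. The Levi-Civita connection of the
pseudosphere is the tangential part of the flat derivative of the ambient space. -/
def hessian (ψ : ℝ × ℝ → M2) (p v w : ℝ × ℝ) : M2 :=
  tangential (ψ p) (fderiv ℝ (fun q => fderiv ℝ ψ q w) p v)

/-- The tension field, the trace of `∇dψ` with respect to the metric `dx dy`. -/
def tension (ψ : ℝ × ℝ → M2) (p : ℝ × ℝ) : M2 :=
  ∑ a, ∑ b, planeMetric⁻¹ a b • hessian ψ p (coordVec a) (coordVec b)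

/-- Smooth maps from the open set `U` to the pseudosphere with vanishing tension field. -/
structure IsHarmonicMap (U : Set (ℝ × ℝ)) (ψ : ℝ × ℝ → M2) : Prop where
  smooth : ContDiffOn ℝ ∞ ψ U
  mem_S21 : ∀ p ∈ U, ψ p ∈ S21
  tension_eq_zero : ∀ p ∈ U, tension ψ p = 0

/-! ### Loops -/

/-- Absolutely convergent loops `∑ ξ_k λ^k` with real matrix coefficients: the completion of the
Laurent polynomials under `∑ ‖ξ_k‖`. The matrix norm is the maximal absolute row sum; any other
one gives the same loops and an equivalent norm. -/
abbrev Loop : Type := lp (fun _ : ℤ => M2) 1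

theorem Loop.summable_norm (ξ : Loop) : Summable fun k : ℤ => ‖ξ k‖ := by
  have h := (memℓp_gen_iff (p := 1) (by simp)).1 (lp.memℓp ξ)
  simpa using h

theorem summable_shear {f g : ℤ → ℝ} (hf : Summable f) (hg : Summable g) (hf0 : ∀ k, 0 ≤ f k)
    (hg0 : ∀ k, 0 ≤ g k) : Summable fun q : ℤ × ℤ => f q.2 * g (q.1 - q.2) := by
  have h1 : Summable fun q : ℤ × ℤ => f q.1 * g q.2 := hf.mul_of_nonneg hg hf0 hg0
  have hi : Function.Injective fun q : ℤ × ℤ => (q.2, q.1 - q.2) := by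
    rintro ⟨a, b⟩ ⟨c, d⟩ h
    simp only [Prod.mk.injEq] at h ⊢
    omega
  exact h1.comp_injective hi

theorem summable_norm_rows {f : ℤ × ℤ → M2} (h : Summable fun q => ‖f q‖) :
    Summable fun n : ℤ => ‖∑' k : ℤ, f (n, k)‖ := by
  have h4 : Summable fun n : ℤ => ∑' k : ℤ, ‖f (n, k)‖ := h.prod
  refine h4.of_nonneg_of_le (fun _ => norm_nonneg _) (fun n => ?_)
  have h5 := h.prod_factor n
  exact norm_tsum_le_tsum_norm h5

theorem Loop.memℓp_conv (ξ η : Loop) :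
    Memℓp (fun n : ℤ => ∑' k : ℤ, ξ k * η (n - k)) 1 := by
  have h0 : Summable fun q : ℤ × ℤ => ‖ξ q.2 * η (q.1 - q.2)‖ :=
    (summable_shear ξ.summable_norm η.summable_norm (fun _ => norm_nonneg _)
      (fun _ => norm_nonneg _)).of_nonneg_of_le (fun _ => norm_nonneg _) (fun _ => norm_mul_le _ _)
  have h := summable_norm_rows h0
  refine memℓp_gen ?_
  simpa only [ENNReal.toReal_one, Real.rpow_one] using h

/-- The pointwise product of loops; on coefficients it is the convolution. -/
def Loop.mul (ξ η : Loop) : Loop :=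
  ⟨fun n : ℤ => ∑' k : ℤ, ξ k * η (n - k), Loop.memℓp_conv ξ η⟩

/-- The loop `X λ^k`. -/
def Loop.monomial (k : ℤ) (X : M2) : Loop := lp.single 1 k X

/-- The constant loop `1`. -/
def Loop.one : Loop := Loop.monomial 0 1

/-- The value of a loop at a point of the unit circle. -/
def Loop.eval (ξ : Loop) (z : ℂ) : Matrix (Fin 2) (Fin 2) ℂ :=
  ∑' k : ℤ, z ^ k • (ξ k).map (fun a : ℝ => (a : ℂ))

/-- The value `∑ ξ_k λ^k` at a real `λ ≠ 0`. It is used for loops which extend analytically to the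
punctured plane; there the Laurent series converges absolutely to the extension. -/
def Loop.evalReal (ξ : Loop) (t : ℝ) : M2 := ∑' k : ℤ, t ^ k • ξ k

/-- `σ(ξ(λ)) = ξ(-λ)`, in terms of coefficients. -/
def IsTwisted (ξ : Loop) : Prop := ∀ k : ℤ, sigma (ξ k) = (-1 : ℝ) ^ k • ξ k

/-- The twisted loop algebra of `sl(2, ℝ)`. -/
def loopAlg : Set Loop := {ξ | (∀ k : ℤ, (ξ k).trace = 0) ∧ IsTwisted ξ}

/-- The twisted loop group of `SL(2, ℝ)`. -/
def loopGroup : Set Loop := {γ | (∀ z : ℂ, ‖z‖ = 1 → (γ.eval z).det = 1) ∧ IsTwisted γ}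

/-- The loop extends to a holomorphic function on the punctured plane. -/
def ExtendsAnalytically (γ : Loop) : Prop :=
  ∃ F : ℂ → Matrix (Fin 2) (Fin 2) ℂ,
    (∀ i j, DifferentiableOn ℂ (fun z => F z i j) {0}ᶜ) ∧ ∀ z : ℂ, ‖z‖ = 1 → F z = γ.eval z

/-- The analytic twisted loop group. -/
def loopGroupAn : Set Loop := {γ | γ ∈ loopGroup ∧ ExtendsAnalytically γ}

/-- Twisted group loops with powers `k ≥ 0` only. -/
def loopGroupPlus : Set Loop := {γ | γ ∈ loopGroup ∧ ∀ k : ℤ, k < 0 → γ k = 0}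

/-- Twisted group loops with powers `k ≤ 0` only and constant term `1`. -/
def loopGroupMinusStar : Set Loop := {γ | γ ∈ loopGroup ∧ (∀ k : ℤ, 0 < k → γ k = 0) ∧ γ 0 = 1}

/-- `(g, h) = (Ψ, Ψ) (M, N)` with `M` in the normalized minus group and `N` in the plus group. -/
structure IsIwasawa (g h Ψ M N : Loop) : Prop where
  mem : Ψ ∈ loopGroup
  minus : M ∈ loopGroupMinusStar
  plus : N ∈ loopGroupPlus
  fst_eq : g = Ψ.mul M
  snd_eq : h = Ψ.mul N

/-! ### Potentials and framings -/

/-- `dΨ = Ψ (a dx + b dy)` on the open set `U`. -/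
def SolvesFrame (U : Set (ℝ × ℝ)) (Ψ a b : ℝ × ℝ → Loop) : Prop :=
  DifferentiableOn ℝ Ψ U ∧
    ∀ p ∈ U, fderiv ℝ Ψ p (1, 0) = (Ψ p).mul (a p) ∧ fderiv ℝ Ψ p (0, 1) = (Ψ p).mul (b p)

/-- `ξ dx` is a Lorentz-holomorphic `1`-form on `D` whose values are twisted loops with powers
`k ≤ 1`. -/
structure IsPotentialX (D : Set (ℝ × ℝ)) (ξ : ℝ × ℝ → Loop) : Prop where
  smooth : ContDiffOn ℝ ∞ ξ D
  mem : ∀ p ∈ D, ξ p ∈ loopAlg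
  powers : ∀ p ∈ D, ∀ k : ℤ, 1 < k → ξ p k = 0
  holomorphic : ∀ p ∈ D, fderiv ℝ ξ p (0, 1) = 0

/-- `ξ dy` is a Lorentz-antiholomorphic `1`-form on `D` whose values are twisted loops with powers
`k ≥ -1`. -/
structure IsPotentialY (D : Set (ℝ × ℝ)) (ξ : ℝ × ℝ → Loop) : Prop where
  smooth : ContDiffOn ℝ ∞ ξ D
  mem : ∀ p ∈ D, ξ p ∈ loopAlg
  powers : ∀ p ∈ D, ∀ k : ℤ, k < -1 → ξ p k = 0
  antiholomorphic : ∀ p ∈ D, fderiv ℝ ξ p (1, 0) = 0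

/-- The loops `ξ p` extend holomorphically to the punctured plane, continuously in `p`. -/
def AnalyticLoops (D : Set (ℝ × ℝ)) (ξ : ℝ × ℝ → Loop) : Prop :=
  ∃ F : ℝ × ℝ → ℂ → Matrix (Fin 2) (Fin 2) ℂ,
    ContinuousOn (fun q : (ℝ × ℝ) × ℂ => F q.1 q.2) (D ×ˢ {0}ᶜ) ∧
    (∀ p ∈ D, ∀ i j, DifferentiableOn ℂ (fun z => F p z i j) {0}ᶜ) ∧
    ∀ p ∈ D, ∀ z : ℂ, ‖z‖ = 1 → F p z = (ξ p).eval z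

/-- Extended framings: smooth `Ψ` with values in the analytic twisted loop group, equal to `1` at
the origin, with `Ψ⁻¹ dΨ = (A + λ B) dx + (C + λ⁻¹ E) dy`, where `A, C` are `𝔨`-valued and `B, E`
are `𝔪`-valued. -/
def IsExtendedFraming (U : Set (ℝ × ℝ)) (Ψ : ℝ × ℝ → Loop) : Prop :=
  ContDiffOn ℝ ∞ Ψ U ∧ (∀ p ∈ U, Ψ p ∈ loopGroupAn) ∧ Ψ (0, 0) = Loop.one ∧
    ∃ A B C E : ℝ × ℝ → M2,
      ContDiffOn ℝ ∞ A U ∧ ContDiffOn ℝ ∞ B U ∧ ContDiffOn ℝ ∞ C U ∧ ContDiffOn ℝ ∞ E U ∧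
      (∀ p ∈ U, A p ∈ kPart ∧ B p ∈ mPart ∧ C p ∈ kPart ∧ E p ∈ mPart) ∧
      SolvesFrame U Ψ (fun p => Loop.monomial 0 (A p) + Loop.monomial 1 (B p))
        (fun p => Loop.monomial 0 (C p) + Loop.monomial (-1) (E p))

/-- The solution of `dΨ = Ψ (a dx + b dy)`, `Ψ(0, 0) = 1` on `D`: it is smooth, takes values in the
twisted loop group, and every other solution agrees with it on `D`. -/
structure IsTheSolution (D : Set (ℝ × ℝ)) (Ψ a b : ℝ × ℝ → Loop) : Prop where
  smooth : ContDiffOn ℝ ∞ Ψ D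
  mem : ∀ p ∈ D, Ψ p ∈ loopGroup
  solves : SolvesFrame D Ψ a b
  init : Ψ (0, 0) = Loop.one
  unique : ∀ Φ : ℝ × ℝ → Loop, SolvesFrame D Φ a b → Φ (0, 0) = Loop.one → Set.EqOn Φ Ψ D

end Timelike

end

/-!
A loop near `1` has a Birkhoff factorization: it solves a linear Toeplitz equation which is a
small perturbation of the identity. Splitting `(g, h) = (Ψ, Ψ)(M, N)` amounts to such a
factorization of `h⁻¹ g = N⁻¹ M`, and after translation to a base point which splits it becomes one
near `1`; so splittings exist on an open set and depend smoothly on `(g, h)`.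

The Maurer-Cartan form of `Ψ = Ψ' M⁻¹ = Ψ'' N⁻¹` is computed in two ways. Along `y` the first
expression gives only negative powers and the second only powers `≥ -1`, so just `λ⁻¹` survives.
Along `x` the powers are `0` and `1`, and the coefficient of `λ` is that of `ξ'`, because `M` has
constant term `1`. It does not depend on `y`, which makes the maps `Ad(Ψ) 𝐤'` harmonic.

Analyticity comes from dilations `λ ↦ s λ`. They are bounded on series with powers `≤ 1` if `s ≥ 1`
and on series with powers `≥ -1` if `s ≤ 1`, and the linear equations for `Ψ'` and `Ψ''` can be
solved for the dilated potentials; so `Ψ` can be dilated by every `s > 0` and its Laurent series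
converges on the punctured plane.
-/

noncomputable section

namespace Timelike

/-! ### Convolution of absolutely summable families -/

section Convolution

theorem summable_norm_coeff {ι E : Type*} [NormedAddCommGroup E] (f : lp (fun _ : ι => E) 1) :
    Summable fun k => ‖f k‖ := by
  simpa using (memℓp_gen_iff (p := 1) (by simp)).1 (lp.memℓp f)

theorem norm_eq_tsum_norm {ι E : Type*} [NormedAddCommGroup E] (f : lp (fun _ : ι => E) 1) :
    ‖f‖ = ∑' k, ‖f k‖ := by
  simpa using lp.norm_eq_tsum_rpow (p := 1) (by simp) f

theorem summable_norm_mul_norm {ι E : Type*} [NormedAddCommGroup E]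
    (f g : lp (fun _ : ι => E) 1) : Summable fun q : ι × ι => ‖f q.1‖ * ‖g q.2‖ :=
  (summable_norm_coeff f).mul_of_nonneg (summable_norm_coeff g) (fun _ => norm_nonneg _)
    fun _ => norm_nonneg _

variable {Γ A : Type*} [AddCommGroup Γ] [NormedRing A]

/-- The shear `(n, k) ↦ (k, n - k)`, which turns the double series of a product into the series of
its convolution sums. -/
def shear (Γ : Type*) [AddCommGroup Γ] : Γ × Γ ≃ Γ × Γ where
  toFun q := (q.2, q.1 - q.2)
  invFun q := (q.1 + q.2, q.1)
  left_inv q := by simp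
  right_inv q := by simp

theorem summable_norm_conv (f g : lp (fun _ : Γ => A) 1) :
    Summable fun q : Γ × Γ => ‖f q.2 * g (q.1 - q.2)‖ :=
  ((shear Γ).summable_iff.2 (summable_norm_mul_norm f g)).of_nonneg_of_le
    (fun _ => norm_nonneg _) fun _ => norm_mul_le _ _

theorem norm_tsum_conv_le (f g : lp (fun _ : Γ => A) 1) (n : Γ) :
    ‖∑' k, f k * g (n - k)‖ ≤ ∑' k, ‖f k * g (n - k)‖ :=
  norm_tsum_le_tsum_norm ((summable_norm_conv f g).prod_factor n)

theorem summable_norm_tsum_conv (f g : lp (fun _ : Γ => A) 1) :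
    Summable fun n : Γ => ‖∑' k, f k * g (n - k)‖ :=
  (summable_norm_conv f g).prod.of_nonneg_of_le (fun _ => norm_nonneg _) (norm_tsum_conv_le f g)

/-- The product of Laurent series: the convolution of their coefficients. -/
scoped instance : Mul (lp (fun _ : Γ => A) 1) where
  mul f g := ⟨fun n => ∑' k, f k * g (n - k), memℓp_gen <| by
    simpa only [ENNReal.toReal_one, Real.rpow_one] using summable_norm_tsum_conv f g⟩

theorem mul_coeff (f g : lp (fun _ : Γ => A) 1) (n : Γ) :
    (f * g) n = ∑' k, f k * g (n - k) := rfl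

theorem norm_conv_le (f g : lp (fun _ : Γ => A) 1) : ‖f * g‖ ≤ ‖f‖ * ‖g‖ := by
  rw [norm_eq_tsum_norm (f * g), norm_eq_tsum_norm f, norm_eq_tsum_norm g]
  calc ∑' n, ‖∑' k, f k * g (n - k)‖
    _ ≤ ∑' n, ∑' k, ‖f k * g (n - k)‖ :=
      (summable_norm_tsum_conv f g).tsum_le_tsum (norm_tsum_conv_le f g)
        (summable_norm_conv f g).prod
    _ = ∑' q : Γ × Γ, ‖f q.2 * g (q.1 - q.2)‖ := (summable_norm_conv f g).tsum_prod.symm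
    _ ≤ ∑' q : Γ × Γ, ‖f q.2‖ * ‖g (q.1 - q.2)‖ :=
      (summable_norm_conv f g).tsum_le_tsum (fun _ => norm_mul_le _ _)
        ((shear Γ).summable_iff.2 (summable_norm_mul_norm f g))
    _ = ∑' q : Γ × Γ, ‖f q.1‖ * ‖g q.2‖ := (shear Γ).tsum_eq fun q => ‖f q.1‖ * ‖g q.2‖
    _ = (∑' k, ‖f k‖) * ∑' k, ‖g k‖ :=
      ((summable_norm_coeff f).tsum_mul_tsum (summable_norm_coeff g)
        (summable_norm_mul_norm f g)).symm

theorem one_conv [DecidableEq Γ] (f : lp (fun _ : Γ => A) 1) : lp.single 1 0 (1 : A) * f = f := by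
  ext n
  rw [mul_coeff, tsum_eq_single 0 fun k hk => by rw [lp.single_apply_ne _ _ _ hk, zero_mul],
    lp.single_apply_self, one_mul, sub_zero]

theorem conv_one [DecidableEq Γ] (f : lp (fun _ : Γ => A) 1) : f * lp.single 1 0 (1 : A) = f := by
  ext n
  rw [mul_coeff, tsum_eq_single n fun k hk => by
      rw [lp.single_apply_ne _ _ _ (sub_ne_zero.2 hk.symm), mul_zero],
    sub_self, lp.single_apply_self, mul_one]

variable [CompleteSpace A]

theorem summable_conv (f g : lp (fun _ : Γ => A) 1) (n : Γ) : Summable fun k => f k * g (n - k) :=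
  ((summable_norm_conv f g).prod_factor n).of_norm

theorem summable_triple_conv (f g h : lp (fun _ : Γ => A) 1) (n : Γ) :
    Summable (Function.uncurry fun k j => f j * g (k - j) * h (n - k)) := by
  have bound (q : Γ × Γ) : ‖f q.2 * g (q.1 - q.2) * h (n - q.1)‖ ≤ ‖f q.2 * g (q.1 - q.2)‖ * ‖h‖ :=
    (norm_mul_le _ _).trans <|
      mul_le_mul_of_nonneg_left (lp.norm_apply_le_norm one_ne_zero h _) (norm_nonneg _)
  have norms : Summable fun q : Γ × Γ => ‖f q.2 * g (q.1 - q.2) * h (n - q.1)‖ :=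
    ((summable_norm_conv f g).mul_right ‖h‖).of_nonneg_of_le (fun _ => norm_nonneg _) bound
  exact norms.of_norm

theorem conv_assoc (f g h : lp (fun _ : Γ => A) 1) : f * g * h = f * (g * h) := by
  ext n
  simp only [mul_coeff]
  calc ∑' k, (∑' j, f j * g (k - j)) * h (n - k)
    _ = ∑' k, ∑' j, f j * g (k - j) * h (n - k) :=
      tsum_congr fun k => ((summable_conv f g k).tsum_mul_right (h (n - k))).symm
    _ = ∑' j, ∑' k, f j * g (k - j) * h (n - k) := (summable_triple_conv f g h n).tsum_comm.symm
    _ = ∑' j, ∑' k, f j * (g k * h (n - j - k)) := tsum_congr fun j => by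
      rw [← (Equiv.addRight j).tsum_eq]
      simp only [Equiv.coe_addRight, add_sub_cancel_right, mul_assoc, sub_sub, add_comm j]
    _ = ∑' j, f j * ∑' k, g k * h (n - j - k) :=
      tsum_congr fun j => (summable_conv g h (n - j)).tsum_mul_left (f j)

theorem add_conv (f g h : lp (fun _ : Γ => A) 1) : (f + g) * h = f * h + g * h := by
  ext n
  simp only [mul_coeff, lp.coeFn_add, Pi.add_apply, add_mul]
  exact (summable_conv f h n).tsum_add (summable_conv g h n)

theorem conv_add (f g h : lp (fun _ : Γ => A) 1) : f * (g + h) = f * g + f * h := by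
  ext n
  simp only [mul_coeff, lp.coeFn_add, Pi.add_apply, mul_add]
  exact (summable_conv f g n).tsum_add (summable_conv f h n)

variable [DecidableEq Γ]

scoped instance : NormedRing (lp (fun _ : Γ => A) 1) where
  __ := (inferInstance : NormedAddCommGroup (lp (fun _ : Γ => A) 1))
  one := lp.single 1 0 1
  mul_assoc := conv_assoc
  one_mul := one_conv
  mul_one := conv_one
  left_distrib := conv_add
  right_distrib := add_conv
  zero_mul f := by ext n; simp [mul_coeff]
  mul_zero f := by ext n; simp [mul_coeff]
  norm_mul_le := norm_conv_le

theorem one_eq_single : (1 : lp (fun _ : Γ => A) 1) = lp.single 1 0 1 := rfl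

variable [NormedAlgebra ℝ A]

scoped instance : NormedAlgebra ℝ (lp (fun _ : Γ => A) 1) where
  __ := Algebra.ofModule
    (fun c f g => by
      ext n
      simp only [mul_coeff, lp.coeFn_smul, Pi.smul_apply, smul_mul_assoc]
      exact (summable_conv f g n).tsum_const_smul c)
    fun c f g => by
      ext n
      simp only [mul_coeff, lp.coeFn_smul, Pi.smul_apply, mul_smul_comm]
      exact (summable_conv f g n).tsum_const_smul c
  norm_smul_le := norm_smul_le

end Convolution

/-! ### Graded maps and supports -/

section Graded

variable {Γ A R : Type*} [NormedRing A] [NormedAlgebra ℝ A] [NormedRing R] [NormedAlgebra ℝ R]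

theorem summable_norm_graded {φ : Γ → A →L[ℝ] R} {K : ℝ} (hφ : ∀ k, ‖φ k‖ ≤ K)
    (f : lp (fun _ : Γ => A) 1) : Summable fun k => ‖φ k (f k)‖ :=
  ((summable_norm_coeff f).mul_left K).of_nonneg_of_le (fun _ => norm_nonneg _)
    fun k => (φ k).le_of_opNorm_le (hφ k) _

variable [AddCommGroup Γ] [CompleteSpace A]

theorem mapCLM_mul {φ : Γ → A →L[ℝ] R} {K : ℝ} (hK : 0 ≤ K) (hφ : ∀ k, ‖φ k‖ ≤ K)
    (mul : ∀ k l X Y, φ (k + l) (X * Y) = φ k X * φ l Y) (f g : lp (fun _ : Γ => A) 1) :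
    lp.mapCLM 1 φ hK hφ (f * g) = lp.mapCLM 1 φ hK hφ f * lp.mapCLM 1 φ hK hφ g := by
  ext n
  simp only [mul_coeff, lp.mapCLM_apply_coe]
  rw [(φ n).map_tsum (summable_conv f g n)]
  exact tsum_congr fun k => by rw [← mul, add_sub_cancel]

theorem tsum_graded_mul [CompleteSpace R] {φ : Γ → A →L[ℝ] R} {K : ℝ} (hφ : ∀ k, ‖φ k‖ ≤ K)
    (mul : ∀ k l X Y, φ (k + l) (X * Y) = φ k X * φ l Y) (f g : lp (fun _ : Γ => A) 1) :
    ∑' n, φ n ((f * g) n) = (∑' k, φ k (f k)) * ∑' k, φ k (g k) := by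
  have hf := summable_norm_graded hφ f
  have hg := summable_norm_graded hφ g
  have sheared : Summable fun q : Γ × Γ => φ q.2 (f q.2) * φ (q.1 - q.2) (g (q.1 - q.2)) :=
    (shear Γ).summable_iff.2 (summable_mul_of_summable_norm hf hg)
  calc ∑' n, φ n ((f * g) n)
    _ = ∑' n, ∑' k, φ n (f k * g (n - k)) :=
      tsum_congr fun n => (φ n).map_tsum (summable_conv f g n)
    _ = ∑' n, ∑' k, φ k (f k) * φ (n - k) (g (n - k)) :=
      tsum_congr fun n => tsum_congr fun k => by rw [← mul, add_sub_cancel]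
    _ = ∑' q : Γ × Γ, φ q.2 (f q.2) * φ (q.1 - q.2) (g (q.1 - q.2)) := sheared.tsum_prod.symm
    _ = ∑' q : Γ × Γ, φ q.1 (f q.1) * φ q.2 (g q.2) :=
      (shear Γ).tsum_eq fun q => φ q.1 (f q.1) * φ q.2 (g q.2)
    _ = (∑' k, φ k (f k)) * ∑' k, φ k (g k) := (tsum_mul_tsum_of_summable_norm hf hg).symm

end Graded

section Support

variable {Γ A : Type*} [NormedRing A] [NormedAlgebra ℝ A]

/-- The series `∑ X_k λ^k` in which only the powers `k ∈ s` occur. -/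
def powersIn (s : Set Γ) : Submodule ℝ (lp (fun _ : Γ => A) 1) where
  carrier := {f | ∀ k ∉ s, f k = 0}
  add_mem' hf hg k hk := by rw [lp.coeFn_add, Pi.add_apply, hf k hk, hg k hk, add_zero]
  zero_mem' := fun _ _ => rfl
  smul_mem' c _ hf k hk := by rw [lp.coeFn_smul, Pi.smul_apply, hf k hk, smul_zero]

variable {s t : Set Γ} {f g : lp (fun _ : Γ => A) 1}

theorem mem_powersIn : f ∈ powersIn s ↔ ∀ k ∉ s, f k = 0 := Iff.rfl

theorem powersIn_mono (h : s ⊆ t) :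
    (powersIn s : Submodule ℝ (lp (fun _ : Γ => A) 1)) ≤ powersIn t :=
  fun _ hf k hk => hf k fun hs => hk (h hs)

theorem mapCLM_mem_powersIn {φ : Γ → A →L[ℝ] A} {K : ℝ} (hK : 0 ≤ K) (hφ : ∀ k, ‖φ k‖ ≤ K)
    (hf : f ∈ powersIn s) : lp.mapCLM 1 φ hK hφ f ∈ powersIn s := fun k hk => by
  rw [lp.mapCLM_apply_coe, hf k hk, map_zero]

theorem eq_single_of_mem_powersIn [DecidableEq Γ] {k : Γ} (hf : f ∈ powersIn {k}) :
    f = lp.single 1 k (f k) := by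
  ext l
  rcases eq_or_ne l k with rfl | hl
  · rw [lp.single_apply_self]
  · rw [lp.single_apply_ne _ _ _ hl, hf l hl]

theorem eq_single_add_single_of_mem_powersIn [DecidableEq Γ] {k l : Γ} (hkl : k ≠ l)
    (hf : f ∈ powersIn {k, l}) : f = lp.single 1 k (f k) + lp.single 1 l (f l) := by
  ext n
  rw [lp.coeFn_add, Pi.add_apply]
  rcases eq_or_ne n k with rfl | hk
  · rw [lp.single_apply_self, lp.single_apply_ne _ _ _ hkl, add_zero]
  rcases eq_or_ne n l with rfl | hl
  · rw [lp.single_apply_self, lp.single_apply_ne _ _ _ hk, zero_add]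
  · rw [lp.single_apply_ne _ _ _ hk, lp.single_apply_ne _ _ _ hl, add_zero]
    exact mem_powersIn.1 hf n (by simp [hk, hl])

open scoped Pointwise in
theorem mul_mem_powersIn [AddCommGroup Γ] (hf : f ∈ powersIn s) (hg : g ∈ powersIn t) :
    f * g ∈ powersIn (s + t) := fun n hn => by
  refine (tsum_congr fun k => ?_).trans tsum_zero
  by_cases hk : k ∈ s
  · rw [hg (n - k) fun hl => hn ⟨k, hk, n - k, hl, add_sub_cancel k n⟩, mul_zero]
  · rw [hf k hk, zero_mul]

theorem one_mem_powersIn [AddCommGroup Γ] [DecidableEq Γ] [CompleteSpace A] (h : (0 : Γ) ∈ s) :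
    (1 : lp (fun _ : Γ => A) 1) ∈ powersIn s := fun _ hk =>
  lp.single_apply_ne _ _ _ fun hk0 => hk (hk0 ▸ h)

/-- The projection `∑ X_k λ^k ↦ ∑_{k ∈ s} X_k λ^k`. -/
def restrictPowers (s : Set Γ) [DecidablePred (· ∈ s)] :
    lp (fun _ : Γ => A) 1 →L[ℝ] lp (fun _ : Γ => A) 1 :=
  lp.mapCLM 1 (fun k => if k ∈ s then .id ℝ A else 0) zero_le_one fun k => by
    split_ifs
    · exact ContinuousLinearMap.norm_id_le
    · simp only [norm_zero, zero_le_one]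

theorem norm_restrictPowers_le (s : Set Γ) [DecidablePred (· ∈ s)] :
    ‖(restrictPowers s : lp (fun _ : Γ => A) 1 →L[ℝ] _)‖ ≤ 1 :=
  lp.norm_mapCLM_le _ _ zero_le_one _

variable [DecidablePred (· ∈ s)]

theorem restrictPowers_coeff (f : lp (fun _ : Γ => A) 1) (k : Γ) :
    restrictPowers s f k = if k ∈ s then f k else 0 := by
  rw [restrictPowers, lp.mapCLM_apply_coe]
  split_ifs <;> rfl

theorem restrictPowers_eq_self_iff : restrictPowers s f = f ↔ f ∈ powersIn s := by
  simp only [lp.ext_iff, funext_iff, restrictPowers_coeff, mem_powersIn, ite_eq_left_iff,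
    eq_comm (a := (0 : A))]

theorem restrictPowers_eq_zero_iff : restrictPowers s f = 0 ↔ f ∈ powersIn sᶜ := by
  simp only [lp.ext_iff, funext_iff, restrictPowers_coeff, mem_powersIn, lp.coeFn_zero,
    Pi.zero_apply, ite_eq_right_iff, Set.mem_compl_iff, not_not]

theorem restrictPowers_mem (f : lp (fun _ : Γ => A) 1) : restrictPowers s f ∈ powersIn s :=
  fun k hk => by rw [restrictPowers_coeff, if_neg hk]

end Support

section HalfLines

variable {Γ A : Type*} [LinearOrder Γ] [NormedRing A] [NormedAlgebra ℝ A] {m n : Γ}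
  {f g : lp (fun _ : Γ => A) 1}

theorem mem_powersIn_Iic : f ∈ powersIn (Set.Iic n) ↔ ∀ k, n < k → f k = 0 := by
  simp only [mem_powersIn, Set.mem_Iic, not_le]

theorem mem_powersIn_Ici : f ∈ powersIn (Set.Ici n) ↔ ∀ k < n, f k = 0 := by
  simp only [mem_powersIn, Set.mem_Ici, not_le]

variable [AddCommGroup Γ] [IsOrderedAddMonoid Γ]

theorem mul_mem_powersIn_Iic (hf : f ∈ powersIn (Set.Iic m)) (hg : g ∈ powersIn (Set.Iic n)) :
    f * g ∈ powersIn (Set.Iic (m + n)) :=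
  powersIn_mono (Set.Iic_add_Iic_subset m n) (mul_mem_powersIn hf hg)

theorem mul_mem_powersIn_Ici (hf : f ∈ powersIn (Set.Ici m)) (hg : g ∈ powersIn (Set.Ici n)) :
    f * g ∈ powersIn (Set.Ici (m + n)) :=
  powersIn_mono (Set.Ici_add_Ici_subset m n) (mul_mem_powersIn hf hg)

theorem mul_coeff_top (hf : f ∈ powersIn (Set.Iic m)) (hg : g ∈ powersIn (Set.Iic n)) :
    (f * g) (m + n) = f m * g n := by
  rw [mul_coeff, tsum_eq_single m, add_sub_cancel_left]
  intro k hk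
  rcases hk.lt_or_gt with h | h
  · rw [mem_powersIn_Iic.1 hg _ (lt_sub_iff_add_lt'.2 (add_lt_add_left h n)), mul_zero]
  · rw [mem_powersIn_Iic.1 hf k h, zero_mul]

end HalfLines

/-! ### Factorization near the identity -/

section Factorization

variable {R : Type*} [NormedRing R] [NormedAlgebra ℝ R] (P : R →L[ℝ] R)

/-- The operator `q ↦ q + P ((g - 1) q)`; for a projection `P` it is the Toeplitz operator of `g`
on the range of `P`. -/
def toeplitz (g : R) : R →L[ℝ] R := 1 + P ∘L ContinuousLinearMap.mul ℝ R (g - 1)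

/-- The Birkhoff factor: the solution `Q ∈ 1 + range P` of `P (g Q) = 0`, when `g` is close to `1`
and `P` is a projection with `P 1 = 0`. -/
def minusFactor (g : R) : R := 1 - Ring.inverse (toeplitz P g) (P (g - 1))

variable {P}

theorem toeplitz_apply (g q : R) : toeplitz P g q = q + P ((g - 1) * q) := rfl

theorem contDiff_toeplitz : ContDiff ℝ ∞ (toeplitz P) :=
  contDiff_const.add <| (ContinuousLinearMap.compL ℝ R R R P).contDiff.comp <|
    (ContinuousLinearMap.mul ℝ R).contDiff.comp (contDiff_id.sub contDiff_const)

variable [CompleteSpace R] {g Q : R}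

theorem isUnit_toeplitz (hP : ‖P‖ ≤ 1) (hg : ‖g - 1‖ < 1) : IsUnit (toeplitz P g) := by
  have small : ‖-(P ∘L ContinuousLinearMap.mul ℝ R (g - 1))‖ < 1 :=
    calc ‖-(P ∘L ContinuousLinearMap.mul ℝ R (g - 1))‖
      _ ≤ ‖P‖ * ‖ContinuousLinearMap.mul ℝ R (g - 1)‖ :=
        (norm_neg _).trans_le (ContinuousLinearMap.opNorm_comp_le _ _)
      _ ≤ 1 * ‖g - 1‖ := by
        gcongr
        exact ContinuousLinearMap.opNorm_mul_apply_le ℝ R (g - 1)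
      _ < 1 := by rwa [one_mul]
  simpa only [toeplitz, sub_neg_eq_add] using isUnit_one_sub_of_norm_lt_one small

theorem eq_minusFactor_iff_toeplitz (hP : ‖P‖ ≤ 1) (hg : ‖g - 1‖ < 1) :
    Q = minusFactor P g ↔ toeplitz P g (Q - 1) = -P (g - 1) := by
  obtain ⟨u, hu⟩ := isUnit_toeplitz hP hg
  have inv_left (x : R) : (↑u⁻¹ : R →L[ℝ] R) (toeplitz P g x) = x := by
    rw [← hu]; exact DFunLike.congr_fun u.inv_mul x
  have inv_right (x : R) : toeplitz P g ((↑u⁻¹ : R →L[ℝ] R) x) = x := by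
    rw [← hu]; exact DFunLike.congr_fun u.mul_inv x
  rw [minusFactor, ← hu, Ring.inverse_unit, hu]
  constructor
  · rintro rfl
    rw [sub_sub_cancel_left, map_neg, inv_right]
  · intro h
    rw [← neg_eq_iff_eq_neg.2 h, map_neg, inv_left, sub_neg_eq_add, add_sub_cancel]

theorem eq_minusFactor_iff (hP : ‖P‖ ≤ 1) (idem : ∀ x, P (P x) = P x) (hP1 : P 1 = 0)
    (hg : ‖g - 1‖ < 1) : Q = minusFactor P g ↔ P (Q - 1) = Q - 1 ∧ P (g * Q) = 0 := by
  have expand : P (g * Q) = P (Q - 1) + P ((g - 1) * (Q - 1)) + P (g - 1) :=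
    calc P (g * Q)
      _ = P ((Q - 1) + (g - 1) * (Q - 1) + (g - 1) + 1) := by congr 1; noncomm_ring
      _ = P (Q - 1) + P ((g - 1) * (Q - 1)) + P (g - 1) := by
        rw [map_add, hP1, add_zero, map_add, map_add]
  rw [eq_minusFactor_iff_toeplitz hP hg, toeplitz_apply, ← add_eq_zero_iff_eq_neg, expand]
  constructor
  · intro h
    have : P (Q - 1) = Q - 1 := by
      rw [add_assoc, ← map_add, add_eq_zero_iff_eq_neg] at h
      rw [h, map_neg, idem]
    exact ⟨this, by rw [this, h]⟩
  · rintro ⟨h, h'⟩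
    rwa [h] at h'

theorem contDiffAt_minusFactor (hP : ‖P‖ ≤ 1) (hg : ‖g - 1‖ < 1) :
    ContDiffAt ℝ ∞ (minusFactor P) g := by
  obtain ⟨u, hu⟩ := isUnit_toeplitz hP hg
  have inverse : ContDiffAt ℝ ∞ (fun g => Ring.inverse (toeplitz P g)) g :=
    ContDiffAt.comp (g := Ring.inverse) g (hu ▸ contDiffAt_ringInverse ℝ u)
      contDiff_toeplitz.contDiffAt
  exact contDiffAt_const.sub <| inverse.clm_apply <|
    P.contDiff.contDiffAt.comp g (contDiffAt_id.sub contDiffAt_const)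

end Factorization

/-! ### Values of loops on the unit circle -/

/-- Complex `2 × 2` matrices, the values of loops. -/
abbrev C2 := Matrix (Fin 2) (Fin 2) ℂ

-- The topology of the operator norm has to win over the entrywise one: unification does not see
-- that they agree.
local instance (priority := 2000) uniformM2 : UniformSpace M2 :=
  (inferInstance : PseudoMetricSpace M2).toUniformSpace

local instance (priority := 2000) topM2 : TopologicalSpace M2 :=
  (inferInstance : PseudoMetricSpace M2).toUniformSpace.toTopologicalSpace

local instance (priority := 2000) uniformC2 : UniformSpace C2 :=
  (inferInstance : PseudoMetricSpace C2).toUniformSpace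

local instance (priority := 2000) topC2 : TopologicalSpace C2 :=
  (inferInstance : PseudoMetricSpace C2).toUniformSpace.toTopologicalSpace

section Fourier

variable {E : Type*} [NormedAddCommGroup E] [NormedSpace ℂ E]

theorem ne_zero_of_norm_eq_one {z : ℂ} (hz : ‖z‖ = 1) : z ≠ 0 :=
  norm_ne_zero_iff.1 (hz ▸ one_ne_zero)

theorem circleIntegral_zpow (n : ℤ) :
    (∮ z in C(0, 1), z ^ n) = if n = -1 then 2 * Real.pi * Complex.I else 0 := by
  split_ifs with h
  · simpa only [h, zpow_neg_one, sub_zero] using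
      circleIntegral.integral_sub_center_inv 0 one_ne_zero
  · simpa only [sub_zero] using circleIntegral.integral_sub_zpow_of_ne h 0 0 1

theorem circleIntegral_zpow_smul_zpow_smul [CompleteSpace E] (k n : ℤ) (c : E) :
    (∮ z in C(0, 1), z ^ (-n - 1) • z ^ k • c)
      = if k = n then (2 * Real.pi * Complex.I : ℂ) • c else 0 := by
  have merge : (∮ z in C(0, 1), z ^ (-n - 1) • z ^ k • c) = ∮ z in C(0, 1), z ^ (-n - 1 + k) • c :=
    circleIntegral.integral_congr zero_le_one fun z hz => by
      rw [smul_smul, ← zpow_add₀ (ne_zero_of_norm_eq_one (by simpa using hz))]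
  rw [merge, circleIntegral.integral_smul_const, circleIntegral_zpow, ite_smul, zero_smul]
  exact if_congr (by omega) rfl rfl

theorem hasSum_circleIntegral_laurent {c : ℤ → E} (hc : Summable fun k => ‖c k‖) [CompleteSpace E]
    (n : ℤ) : HasSum (fun k => ∮ z in C(0, 1), z ^ (-n - 1) • z ^ k • c k)
      (∮ z in C(0, 1), z ^ (-n - 1) • ∑' k, z ^ k • c k) := by
  have continuous_zpow (m : ℤ) : Continuous fun θ : ℝ => circleMap 0 1 θ ^ m :=
    (continuous_circleMap 0 1).zpow₀ m fun _ => Or.inl (circleMap_ne_center one_ne_zero)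
  refine intervalIntegral.hasSum_integral_of_dominated_convergence (fun k _ => ‖c k‖)
    (fun k => Continuous.aestronglyMeasurable ?_) (fun k => ?_) (.of_forall fun _ _ => hc)
    intervalIntegrable_const (.of_forall fun θ _ => ?_)
  · simp only [deriv_circleMap]
    have := continuous_circleMap 0 1
    have := continuous_zpow (-n - 1)
    have := continuous_zpow k
    fun_prop
  · exact .of_forall fun θ _ => by simp [norm_smul]
  · have : Summable fun k => circleMap 0 1 θ ^ k • c k :=
      (hc.congr fun k => by simp [norm_smul]).of_norm
    exact (this.hasSum.const_smul _).const_smul _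

theorem circleIntegral_laurent [CompleteSpace E] {c : ℤ → E} (hc : Summable fun k => ‖c k‖)
    (n : ℤ) : (∮ z in C(0, 1), z ^ (-n - 1) • ∑' k, z ^ k • c k)
      = (2 * Real.pi * Complex.I : ℂ) • c n := by
  rw [← (hasSum_circleIntegral_laurent hc n).tsum_eq]
  simp only [circleIntegral_zpow_smul_zpow_smul]
  rw [tsum_eq_single n fun k hk => if_neg hk, if_pos rfl]

end Fourier

/-- The entrywise inclusion of real into complex matrices. -/
def complexify : M2 →L[ℝ] C2 :=
  (Complex.ofRealAm.mapMatrix : M2 →ₐ[ℝ] C2).toLinearMap.toContinuousLinearMap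

theorem complexify_apply (X : M2) (i j : Fin 2) : complexify X i j = X i j := rfl

theorem complexify_injective : Function.Injective complexify := fun X Y h => by
  ext i j
  exact Complex.ofReal_injective (congrFun₂ h i j)

theorem complexify_one : complexify 1 = 1 := map_one (Complex.ofRealAm.mapMatrix : M2 →ₐ[ℝ] C2)

theorem complexify_mul (X Y : M2) : complexify (X * Y) = complexify X * complexify Y :=
  map_mul (Complex.ofRealAm.mapMatrix : M2 →ₐ[ℝ] C2) X Y

/-- The term `X ↦ z ^ k X` of a Laurent series. -/
def laurentTerm (z : ℂ) (k : ℤ) : M2 →L[ℝ] C2 := z ^ k • complexify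

section Eval

variable {z : ℂ}

theorem norm_laurentTerm_le (hz : ‖z‖ = 1) (k : ℤ) : ‖laurentTerm z k‖ ≤ ‖complexify‖ := by
  rw [laurentTerm, norm_smul, norm_zpow, hz, one_zpow, one_mul]

theorem laurentTerm_mul (hz : z ≠ 0) (k l : ℤ) (X Y : M2) :
    laurentTerm z (k + l) (X * Y) = laurentTerm z k X * laurentTerm z l Y := by
  simp only [laurentTerm, smul_apply, complexify_mul, zpow_add₀ hz,
    smul_mul_smul_comm]

namespace Loop

theorem eval_eq_tsum (ξ : Loop) (z : ℂ) : ξ.eval z = ∑' k, laurentTerm z k (ξ k) := rfl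

theorem summable_eval (ξ : Loop) (hz : ‖z‖ = 1) : Summable fun k => laurentTerm z k (ξ k) :=
  (summable_norm_graded (norm_laurentTerm_le hz) ξ).of_norm

theorem mul_eq (ξ η : Loop) : ξ.mul η = ξ * η := rfl

theorem eval_mul (ξ η : Loop) (hz : ‖z‖ = 1) : (ξ * η).eval z = ξ.eval z * η.eval z :=
  tsum_graded_mul (norm_laurentTerm_le hz) (laurentTerm_mul (ne_zero_of_norm_eq_one hz)) ξ η

theorem eval_one (z : ℂ) : (1 : Loop).eval z = 1 := by
  rw [eval_eq_tsum, tsum_eq_single 0 fun k hk => ?_]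
  · rw [one_eq_single, lp.single_apply_self, laurentTerm, zpow_zero, one_smul, complexify_one]
  · rw [one_eq_single, lp.single_apply_ne _ _ _ hk, map_zero]

theorem summable_norm_complexify (ξ : Loop) : Summable fun k => ‖complexify (ξ k)‖ :=
  summable_norm_graded (φ := fun _ => complexify) (fun _ => le_rfl) ξ

theorem circleIntegral_eval (ξ : Loop) (n : ℤ) : (∮ z in C(0, 1), z ^ (-n - 1) • ξ.eval z)
    = (2 * Real.pi * Complex.I : ℂ) • complexify (ξ n) :=
  circleIntegral_laurent ξ.summable_norm_complexify n

theorem ext_eval {ξ η : Loop} (h : ∀ z : ℂ, ‖z‖ = 1 → ξ.eval z = η.eval z) : ξ = η := by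
  ext1
  funext n
  have integrals : (∮ z in C(0, 1), z ^ (-n - 1) • ξ.eval z)
      = ∮ z in C(0, 1), z ^ (-n - 1) • η.eval z :=
    circleIntegral.integral_congr zero_le_one fun z hz => by
      simp only [h z (by simpa using hz)]
  rw [circleIntegral_eval, circleIntegral_eval] at integrals
  exact complexify_injective (smul_right_injective _ Complex.two_pi_I_ne_zero integrals)

end Loop

end Eval

/-! ### The adjugate and the twist -/

/-- The adjugate, which is linear on `2 × 2` matrices. -/
def adjugateLin (R : Type*) [CommRing R] :
    Matrix (Fin 2) (Fin 2) R →ₗ[R] Matrix (Fin 2) (Fin 2) R where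
  toFun := Matrix.adjugate
  map_add' X Y := by
    simp only [Matrix.adjugate_fin_two, Matrix.add_apply, neg_add]
    ext i j; fin_cases i <;> fin_cases j <;> rfl
  map_smul' c X := by
    rw [Matrix.adjugate_smul, Fintype.card_fin, pow_one, RingHom.id_apply]

theorem complexify_adjugate (X : M2) : complexify X.adjugate = (complexify X).adjugate :=
  Complex.ofRealAm.map_adjugate X

theorem trace_eq_zero_iff_adjugate (X : M2) : X.trace = 0 ↔ X.adjugate = -X := by
  have adjugate_eq : X.adjugate = X.trace • 1 - X := by
    rw [Matrix.adjugate_fin_two, Matrix.trace_fin_two]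
    ext i j; fin_cases i <;> fin_cases j <;> simp
  rw [adjugate_eq, sub_eq_neg_self, smul_eq_zero_iff_left one_ne_zero]

theorem matK_mul_matK : matK * matK = 1 := by
  simp [matK, Matrix.one_fin_two]

theorem sigma_eq (X : M2) : sigma X = matK * X * matK := by
  rw [sigma, Ad, Matrix.inv_eq_right_inv matK_mul_matK]

theorem sigma_entries (X : M2) : sigma X = !![X 0 0, -X 0 1; -X 1 0, X 1 1] := by
  rw [sigma_eq, matK]
  conv_lhs => rw [Matrix.eta_fin_two X, Matrix.mul_fin_two, Matrix.mul_fin_two]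
  simp

theorem sigma_adjugate (X : M2) : sigma X.adjugate = (sigma X).adjugate := by
  simp [sigma_entries, Matrix.adjugate_fin_two]

/-- `σ` as an algebra automorphism. -/
def sigmaLin : M2 →ₐ[ℝ] M2 :=
  AlgHom.ofLinearMap
    { toFun := sigma
      map_add' := fun X Y => by simp only [sigma_eq, mul_add, add_mul]
      map_smul' := fun c X => by
        simp only [sigma_eq, mul_smul_comm, smul_mul_assoc, RingHom.id_apply] }
    (by change sigma 1 = 1; rw [sigma_eq, mul_one, matK_mul_matK])
    fun X Y => by
      change sigma (X * Y) = sigma X * sigma Y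
      simp only [sigma_eq]
      calc matK * (X * Y) * matK = matK * X * 1 * Y * matK := by noncomm_ring
        _ = matK * X * matK * (matK * Y * matK) := by rw [← matK_mul_matK]; noncomm_ring

namespace Loop

/-- The coefficientwise, and hence pointwise, adjugate of a loop. -/
def adj : Loop →L[ℝ] Loop :=
  lp.mapCLM 1 (fun _ => (adjugateLin ℝ).toContinuousLinearMap) (norm_nonneg _) fun _ => le_rfl

theorem adj_coeff (ξ : Loop) (k : ℤ) : adj ξ k = (ξ k).adjugate := rfl

theorem eval_adj (ξ : Loop) {z : ℂ} (hz : ‖z‖ = 1) : (adj ξ).eval z = (ξ.eval z).adjugate :=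
  calc (adj ξ).eval z
    _ = ∑' k, adjugateLin ℂ (laurentTerm z k (ξ k)) := tsum_congr fun k => by
      change z ^ k • complexify (ξ k).adjugate = adjugateLin ℂ (z ^ k • complexify (ξ k))
      rw [map_smul, complexify_adjugate]; rfl
    _ = (ξ.eval z).adjugate :=
      ((adjugateLin ℂ).toContinuousLinearMap.map_tsum (ξ.summable_eval hz)).symm

theorem adj_mul (ξ η : Loop) : adj (ξ * η) = adj η * adj ξ := ext_eval fun z hz => by
  rw [eval_adj _ hz, eval_mul _ _ hz, eval_mul _ _ hz, eval_adj _ hz, eval_adj _ hz,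
    Matrix.adjugate_mul_distrib]

theorem adj_adj (ξ : Loop) : adj (adj ξ) = ξ := by
  ext1
  funext k
  simp [adj_coeff, Matrix.adjugate_adjugate']

theorem adj_one : adj 1 = 1 := ext_eval fun z hz => by
  rw [eval_adj _ hz, eval_one, Matrix.adjugate_one]

theorem det_eval_eq_one_iff (ξ : Loop) :
    (∀ z : ℂ, ‖z‖ = 1 → (ξ.eval z).det = 1) ↔ ξ * adj ξ = 1 := by
  have eval_mul_adj {z : ℂ} (hz : ‖z‖ = 1) : (ξ * adj ξ).eval z = (ξ.eval z).det • 1 := by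
    rw [eval_mul _ _ hz, eval_adj _ hz, Matrix.mul_adjugate]
  constructor
  · exact fun h => ext_eval fun z hz => by rw [eval_mul_adj hz, h z hz, one_smul, eval_one]
  · intro h z hz
    have := eval_mul_adj hz
    rw [h, eval_one] at this
    simpa using congrFun₂ this.symm 0 0

theorem adj_mul_self {ξ : Loop} (h : ξ * adj ξ = 1) : adj ξ * ξ = 1 := ext_eval fun z hz => by
  rw [eval_mul _ _ hz, eval_adj _ hz, Matrix.adjugate_mul, (det_eval_eq_one_iff ξ).2 h z hz,
    one_smul, eval_one]

/-- `ξ * adj ξ` is the scalar loop `det ξ`. -/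
theorem mul_adj_mul (g ξ : Loop) (hg : g * adj g = 1) : g * ξ * adj (g * ξ) = ξ * adj ξ :=
  ext_eval fun z hz => by
    simp only [eval_mul _ _ hz, eval_adj _ hz, Matrix.mul_adjugate, Matrix.det_mul,
      (det_eval_eq_one_iff g).2 hg z hz, one_mul]

/-- The automorphism `ξ(λ) ↦ σ(ξ(-λ))`. -/
def twist : Loop →L[ℝ] Loop :=
  lp.mapCLM 1 (fun k => (-1 : ℝ) ^ k • sigmaLin.toLinearMap.toContinuousLinearMap)
    (K := ‖sigmaLin.toLinearMap.toContinuousLinearMap‖) (norm_nonneg _) fun k => by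
      rw [norm_smul, norm_zpow, norm_neg, norm_one, one_zpow, one_mul]

theorem twist_coeff (ξ : Loop) (k : ℤ) : twist ξ k = (-1 : ℝ) ^ k • sigma (ξ k) := rfl

theorem twist_mul (ξ η : Loop) : twist (ξ * η) = twist ξ * twist η :=
  mapCLM_mul _ _ (fun k l X Y => by
    change (-1 : ℝ) ^ (k + l) • sigmaLin (X * Y)
      = ((-1 : ℝ) ^ k • sigmaLin X) * ((-1 : ℝ) ^ l • sigmaLin Y)
    rw [map_mul, zpow_add₀ (by norm_num), smul_mul_smul_comm]) ξ η

theorem twist_one : twist 1 = 1 := by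
  have twist_one_mem : twist 1 ∈ powersIn {0} :=
    mapCLM_mem_powersIn _ _ (one_mem_powersIn (Set.mem_singleton 0))
  rw [eq_single_of_mem_powersIn twist_one_mem, twist_coeff, one_eq_single, lp.single_apply_self,
    zpow_zero, one_smul, sigma_eq, mul_one, matK_mul_matK]

theorem twist_adj (ξ : Loop) : twist (adj ξ) = adj (twist ξ) := by
  ext1
  funext k
  rw [twist_coeff, adj_coeff, adj_coeff, twist_coeff, Matrix.adjugate_smul, sigma_adjugate,
    Fintype.card_fin, pow_one]

end Loop

open Loop Topology

theorem isTwisted_iff (ξ : Loop) : IsTwisted ξ ↔ twist ξ = ξ := by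
  have coeff_iff (k : ℤ) : sigma (ξ k) = (-1 : ℝ) ^ k • ξ k ↔ twist ξ k = ξ k := by
    rw [twist_coeff, ← inv_smul_eq_iff₀ (zpow_ne_zero k (by norm_num)), ← inv_zpow, inv_neg,
      inv_one]
  simp only [IsTwisted, coeff_iff, lp.ext_iff, funext_iff]

theorem mem_loopAlg_iff (ξ : Loop) : ξ ∈ loopAlg ↔ adj ξ = -ξ ∧ twist ξ = ξ := by
  rw [← isTwisted_iff, lp.ext_iff, funext_iff]
  exact and_congr_left' (forall_congr' fun k => trace_eq_zero_iff_adjugate (ξ k))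

/-! ### The loop group -/

theorem mem_loopGroup_iff (γ : Loop) : γ ∈ loopGroup ↔ γ * adj γ = 1 ∧ twist γ = γ := by
  rw [← isTwisted_iff, ← det_eval_eq_one_iff]; rfl

theorem mul_adj_self {γ : Loop} (h : γ ∈ loopGroup) : γ * adj γ = 1 :=
  ((mem_loopGroup_iff γ).1 h).1

theorem adj_mul_self {γ : Loop} (h : γ ∈ loopGroup) : adj γ * γ = 1 :=
  Loop.adj_mul_self (mul_adj_self h)

theorem mul_adj_cancel_left {γ : Loop} (h : γ ∈ loopGroup) (ξ : Loop) : γ * (adj γ * ξ) = ξ := by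
  rw [← mul_assoc, mul_adj_self h, one_mul]

theorem adj_mul_cancel_left {γ : Loop} (h : γ ∈ loopGroup) (ξ : Loop) : adj γ * (γ * ξ) = ξ := by
  rw [← mul_assoc, adj_mul_self h, one_mul]

theorem one_mem_loopGroup : (1 : Loop) ∈ loopGroup := by
  rw [mem_loopGroup_iff, adj_one, twist_one, mul_one]; exact ⟨rfl, rfl⟩

theorem mul_mem_loopGroup {γ δ : Loop} (h : γ ∈ loopGroup) (h' : δ ∈ loopGroup) :
    γ * δ ∈ loopGroup := by
  rw [mem_loopGroup_iff] at *
  rw [mul_adj_mul γ δ h.1, twist_mul, h.2, h'.2]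
  exact ⟨h'.1, rfl⟩

theorem adj_mem_loopGroup {γ : Loop} (h : γ ∈ loopGroup) : adj γ ∈ loopGroup := by
  rw [mem_loopGroup_iff, adj_adj, twist_adj, ((mem_loopGroup_iff γ).1 h).2]
  exact ⟨adj_mul_self h, rfl⟩

theorem adj_mem_powersIn {s : Set ℤ} {ξ : Loop} (hξ : ξ ∈ powersIn s) : adj ξ ∈ powersIn s :=
  mapCLM_mem_powersIn _ _ hξ

theorem twist_mem_powersIn {s : Set ℤ} {ξ : Loop} (hξ : ξ ∈ powersIn s) : twist ξ ∈ powersIn s :=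
  mapCLM_mem_powersIn _ _ hξ

theorem mem_loopGroupPlus_iff {γ : Loop} :
    γ ∈ loopGroupPlus ↔ γ ∈ loopGroup ∧ γ ∈ powersIn (Set.Ici 0) := by
  rw [mem_powersIn_Ici]; rfl

theorem mem_loopGroupMinusStar_iff {γ : Loop} :
    γ ∈ loopGroupMinusStar ↔ γ ∈ loopGroup ∧ γ ∈ powersIn (Set.Iic 0) ∧ γ 0 = 1 := by
  rw [mem_powersIn_Iic]; rfl

theorem one_coeff_zero : (1 : Loop) 0 = 1 := lp.single_apply_self _ _ _

theorem mul_coeff_zero {ξ η : Loop} (hξ : ξ ∈ powersIn (Set.Iic 0))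
    (hη : η ∈ powersIn (Set.Iic 0)) : (ξ * η) 0 = ξ 0 * η 0 := by
  simpa only [add_zero] using mul_coeff_top hξ hη

theorem eq_one_of_powersIn {ξ : Loop} (hle : ξ ∈ powersIn (Set.Iic 0))
    (hge : ξ ∈ powersIn (Set.Ici 0)) (h0 : ξ 0 = 1) : ξ = 1 := by
  have : ξ ∈ powersIn {0} := fun k hk => by
    rcases lt_or_gt_of_ne hk with h | h
    · exact mem_powersIn_Ici.1 hge k h
    · exact mem_powersIn_Iic.1 hle k h
  rw [eq_single_of_mem_powersIn this, h0, one_eq_single]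

theorem one_mem_loopGroupMinusStar : (1 : Loop) ∈ loopGroupMinusStar :=
  mem_loopGroupMinusStar_iff.2
    ⟨one_mem_loopGroup, one_mem_powersIn Set.self_mem_Iic, one_coeff_zero⟩

theorem one_mem_loopGroupPlus : (1 : Loop) ∈ loopGroupPlus :=
  mem_loopGroupPlus_iff.2 ⟨one_mem_loopGroup, one_mem_powersIn Set.self_mem_Ici⟩

theorem mul_mem_loopGroupMinusStar {γ δ : Loop} (hγ : γ ∈ loopGroupMinusStar)
    (hδ : δ ∈ loopGroupMinusStar) : γ * δ ∈ loopGroupMinusStar := by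
  rw [mem_loopGroupMinusStar_iff] at *
  refine ⟨mul_mem_loopGroup hγ.1 hδ.1, ?_, ?_⟩
  · simpa only [add_zero] using mul_mem_powersIn_Iic hγ.2.1 hδ.2.1
  · rw [mul_coeff_zero hγ.2.1 hδ.2.1, hγ.2.2, hδ.2.2, one_mul]

theorem mul_mem_loopGroupPlus {γ δ : Loop} (hγ : γ ∈ loopGroupPlus) (hδ : δ ∈ loopGroupPlus) :
    γ * δ ∈ loopGroupPlus := by
  rw [mem_loopGroupPlus_iff] at *
  exact ⟨mul_mem_loopGroup hγ.1 hδ.1,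
    by simpa only [add_zero] using mul_mem_powersIn_Ici hγ.2 hδ.2⟩

theorem adj_mem_loopGroupMinusStar {γ : Loop} (h : γ ∈ loopGroupMinusStar) :
    adj γ ∈ loopGroupMinusStar := by
  rw [mem_loopGroupMinusStar_iff] at *
  exact ⟨adj_mem_loopGroup h.1, adj_mem_powersIn h.2.1,
    by rw [adj_coeff, h.2.2, Matrix.adjugate_one]⟩

theorem adj_mem_loopGroupPlus {γ : Loop} (h : γ ∈ loopGroupPlus) : adj γ ∈ loopGroupPlus := by
  rw [mem_loopGroupPlus_iff] at *
  exact ⟨adj_mem_loopGroup h.1, adj_mem_powersIn h.2⟩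

/-! ### The Birkhoff factorization in the loop group -/

/-- The projection of a loop to its negative powers. -/
def negPart : Loop →L[ℝ] Loop := restrictPowers (Set.Iio 0)

theorem norm_negPart_le : ‖negPart‖ ≤ 1 := norm_restrictPowers_le (Set.Iio 0)

theorem negPart_eq_self_iff {ξ : Loop} : negPart ξ = ξ ↔ ξ ∈ powersIn (Set.Iio 0) :=
  restrictPowers_eq_self_iff

theorem negPart_eq_zero_iff {ξ : Loop} : negPart ξ = 0 ↔ ξ ∈ powersIn (Set.Ici 0) := by
  rw [← Set.compl_Iio]; exact restrictPowers_eq_zero_iff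

theorem eq_birkhoff_iff {g Q : Loop} (hg : ‖g - 1‖ < 1) : Q = minusFactor negPart g ↔
    Q - 1 ∈ powersIn (Set.Iio 0) ∧ g * Q ∈ powersIn (Set.Ici 0) := by
  rw [eq_minusFactor_iff norm_negPart_le
    (fun ξ => negPart_eq_self_iff.2 (restrictPowers_mem ξ))
    (negPart_eq_zero_iff.2 (one_mem_powersIn Set.self_mem_Ici)) hg, negPart_eq_self_iff,
    negPart_eq_zero_iff]

theorem powersIn_Iic_and_coeff_of_sub_one {Q : Loop} (h : Q - 1 ∈ powersIn (Set.Iio 0)) :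
    Q ∈ powersIn (Set.Iic 0) ∧ Q 0 = 1 := by
  constructor
  · rw [← sub_add_cancel Q 1]
    exact add_mem (powersIn_mono Set.Iio_subset_Iic_self h) (one_mem_powersIn Set.self_mem_Iic)
  · have : Q 0 - (1 : Loop) 0 = 0 := h 0 Set.self_notMem_Iio
    rw [sub_eq_zero.1 this, one_coeff_zero]

theorem minusFactor_mem {g : Loop} (hg : g ∈ loopGroup) (near : ‖g - 1‖ < 1) :
    minusFactor negPart g ∈ loopGroupMinusStar ∧ g * minusFactor negPart g ∈ loopGroupPlus := by
  obtain ⟨Q, hQ⟩ : ∃ Q, Q = minusFactor negPart g := ⟨_, rfl⟩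
  rw [← hQ]
  obtain ⟨sub_one_mem, mul_mem⟩ := (eq_birkhoff_iff near).1 hQ
  obtain ⟨le, coeff⟩ := powersIn_Iic_and_coeff_of_sub_one sub_one_mem
  -- `det Q = det (g Q)` has only the power `0`, and its constant term is `1`.
  have det_eq_one : Q * adj Q = 1 := by
    refine eq_one_of_powersIn ?_ ?_ ?_
    · simpa only [add_zero] using mul_mem_powersIn_Iic le (adj_mem_powersIn le)
    · rw [← mul_adj_mul g Q (mul_adj_self hg)]
      simpa only [add_zero] using mul_mem_powersIn_Ici mul_mem (adj_mem_powersIn mul_mem)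
    · rw [mul_coeff_zero le (adj_mem_powersIn le), adj_coeff, coeff, Matrix.adjugate_one, one_mul]
  have twist_eq : twist Q = Q := by
    refine ((eq_birkhoff_iff near).2 ⟨?_, ?_⟩).trans hQ.symm
    · rw [← twist_one, ← map_sub]
      exact twist_mem_powersIn sub_one_mem
    · rw [← ((mem_loopGroup_iff g).1 hg).2, ← twist_mul]
      exact twist_mem_powersIn mul_mem
  have mem : Q ∈ loopGroup := (mem_loopGroup_iff Q).2 ⟨det_eq_one, twist_eq⟩
  exact ⟨mem_loopGroupMinusStar_iff.2 ⟨mem, le, coeff⟩,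
    mem_loopGroupPlus_iff.2 ⟨mul_mem_loopGroup hg mem, mul_mem⟩⟩

/-! ### Iwasawa splittings -/

namespace IsIwasawa

theorem unique {g h Ψ M N Ψ' M' N' : Loop} (H : IsIwasawa g h Ψ M N)
    (H' : IsIwasawa g h Ψ' M' N') : Ψ = Ψ' ∧ M = M' ∧ N = N' := by
  have transition {X X' : Loop} (eq : Ψ * X = Ψ' * X') (hX : X ∈ loopGroup) :
      X' * adj X = adj Ψ' * Ψ := by
    rw [← adj_mul_cancel_left H'.mem (X' * adj X), ← mul_assoc Ψ', ← eq, mul_assoc Ψ,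
      mul_adj_self hX, mul_one]
  have fst := transition (H.fst_eq.symm.trans H'.fst_eq) H.minus.1
  have snd := transition (H.snd_eq.symm.trans H'.snd_eq) H.plus.1
  have minus := mul_mem_loopGroupMinusStar H'.minus (adj_mem_loopGroupMinusStar H.minus)
  have plus := mul_mem_loopGroupPlus H'.plus (adj_mem_loopGroupPlus H.plus)
  rw [fst, mem_loopGroupMinusStar_iff] at minus
  rw [snd, mem_loopGroupPlus_iff] at plus
  have trivial : adj Ψ' * Ψ = 1 := eq_one_of_powersIn minus.2.1 plus.2 minus.2.2
  have cancel {X X' : Loop} (hX : X ∈ loopGroup) (eq : X' * adj X = 1) : X = X' := by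
    rw [← mul_one X', ← adj_mul_self hX, ← mul_assoc, eq, one_mul]
  refine ⟨?_, cancel H.minus.1 (fst.trans trivial), cancel H.plus.1 (snd.trans trivial)⟩
  rw [← mul_adj_cancel_left H'.mem Ψ, trivial, mul_one]

theorem one : IsIwasawa 1 1 1 1 1 :=
  ⟨one_mem_loopGroup, one_mem_loopGroupMinusStar, one_mem_loopGroupPlus,
    (mul_one (1 : Loop)).symm, (mul_one (1 : Loop)).symm⟩

variable {g₀ h₀ Ψ₀ M₀ N₀ g h K : Loop}

theorem transition_eq_one (H : IsIwasawa g₀ h₀ Ψ₀ M₀ N₀) :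
    N₀ * adj h₀ * g₀ * adj M₀ = 1 := by
  rw [H.fst_eq, H.snd_eq, mul_eq, mul_eq, adj_mul]
  simp only [mul_assoc, mul_adj_self H.minus.1, mul_one, adj_mul_self H.mem,
    mul_adj_self H.plus.1]

/-- A splitting of `(g, h)` close to `(g₀, h₀)` is a Birkhoff factorization of `K`, which is close
to `1`. -/
theorem near (H : IsIwasawa g₀ h₀ Ψ₀ M₀ N₀) (hg : g ∈ loopGroup) (hh : h ∈ loopGroup)
    (hK : K = N₀ * adj h * g * adj M₀) (near : ‖K - 1‖ < 1) :
    IsIwasawa g h (g * adj M₀ * minusFactor negPart K) (adj (minusFactor negPart K) * M₀)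
      (adj (K * minusFactor negPart K) * N₀) := by
  have K_mem : K ∈ loopGroup := hK ▸ mul_mem_loopGroup (mul_mem_loopGroup
    (mul_mem_loopGroup H.plus.1 (adj_mem_loopGroup hh)) hg) (adj_mem_loopGroup H.minus.1)
  obtain ⟨minus, plus⟩ := minusFactor_mem K_mem near
  refine ⟨mul_mem_loopGroup (mul_mem_loopGroup hg (adj_mem_loopGroup H.minus.1)) minus.1,
    mul_mem_loopGroupMinusStar (adj_mem_loopGroupMinusStar minus) H.minus,
    mul_mem_loopGroupPlus (adj_mem_loopGroupPlus plus) H.plus, ?_, ?_⟩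
  · simp only [mul_eq, mul_assoc, mul_adj_cancel_left minus.1, adj_mul_self H.minus.1, mul_one]
  · change h = g * adj M₀ * minusFactor negPart K * (adj (K * minusFactor negPart K) * N₀)
    rw [adj_mul, mul_assoc (g * adj M₀), mul_assoc (adj (minusFactor negPart K)),
      mul_adj_cancel_left minus.1, hK]
    simp only [adj_mul, adj_adj, mul_assoc, adj_mul_cancel_left H.minus.1, mul_adj_cancel_left hg,
      adj_mul_self H.plus.1, mul_one]

theorem eventually_near {X : Type*} [TopologicalSpace X] {p₀ : X} {g h : X → Loop}
    (H : IsIwasawa (g p₀) (h p₀) Ψ₀ M₀ N₀) (hg : ContinuousAt g p₀) (hh : ContinuousAt h p₀) :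
    ∀ᶠ p in 𝓝 p₀, ‖N₀ * adj (h p) * g p * adj M₀ - 1‖ < 1 := by
  have adj_cont : ContinuousAt (fun p => adj (h p)) p₀ := adj.continuous.continuousAt.comp hh
  refine ((((continuousAt_const.mul adj_cont).mul hg).mul continuousAt_const).sub
    continuousAt_const).norm.eventually_lt continuousAt_const ?_
  simp [H.transition_eq_one]

theorem contDiffAt {E : Type*} [NormedAddCommGroup E] [NormedSpace ℝ E] {g h Ψ M N : E → Loop}
    {p₀ : E} (hg : ContDiffAt ℝ ∞ g p₀) (hh : ContDiffAt ℝ ∞ h p₀)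
    (mem : ∀ᶠ p in 𝓝 p₀, g p ∈ loopGroup ∧ h p ∈ loopGroup)
    (H : ∀ᶠ p in 𝓝 p₀, IsIwasawa (g p) (h p) (Ψ p) (M p) (N p)) :
    ContDiffAt ℝ ∞ M p₀ ∧ ContDiffAt ℝ ∞ N p₀ := by
  have adj_smooth {f : E → Loop} (hf : ContDiffAt ℝ ∞ f p₀) :
      ContDiffAt ℝ ∞ (fun p => adj (f p)) p₀ := adj.contDiff.contDiffAt.comp p₀ hf
  obtain ⟨K, hK⟩ : ∃ K : E → Loop, ∀ p, K p = N p₀ * adj (h p) * g p * adj (M p₀) :=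
    ⟨_, fun _ => rfl⟩
  have K_smooth : ContDiffAt ℝ ∞ K p₀ := by
    rw [funext hK]
    exact ((contDiffAt_const.mul (adj_smooth hh)).mul hg).mul contDiffAt_const
  have K_eq_one : K p₀ = 1 := by rw [hK, H.self_of_nhds.transition_eq_one]
  have K_near : ∀ᶠ p in 𝓝 p₀, ‖K p - 1‖ < 1 := by
    simpa only [hK] using H.self_of_nhds.eventually_near hg.continuousAt hh.continuousAt
  have eq : ∀ᶠ p in 𝓝 p₀, M p = adj (minusFactor negPart (K p)) * M p₀ ∧
      N p = adj (K p * minusFactor negPart (K p)) * N p₀ := by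
    filter_upwards [K_near, mem, H] with p hp hmem Hp
    exact (Hp.unique (H.self_of_nhds.near hmem.1 hmem.2 (hK p) hp)).2
  have factor_smooth : ContDiffAt ℝ ∞ (fun p => minusFactor negPart (K p)) p₀ :=
    (contDiffAt_minusFactor norm_negPart_le (by simp [K_eq_one])).comp p₀ K_smooth
  exact ⟨((adj_smooth factor_smooth).mul contDiffAt_const).congr_of_eventuallyEq
      (eq.mono fun p hp => hp.1),
    ((adj_smooth (K_smooth.mul factor_smooth)).mul contDiffAt_const).congr_of_eventuallyEq
      (eq.mono fun p hp => hp.2)⟩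

end IsIwasawa

/-! ### Locally constant cocycles on simply connected spaces -/

section Cocycle

variable {X G : Type*} [TopologicalSpace X] [Group G]

/-- The covering with fibre `G` over `X` whose transition functions `f i / f j` are locally
constant; its sections are the functions that differ from every `f i` by a locally constant left
factor. -/
def transitionBundle [TopologicalSpace G] [DiscreteTopology G] (V : X → Set X)
    (hV : ∀ i, IsOpen (V i)) (mem : ∀ i, i ∈ V i) (f : X → X → G)
    (hf : ∀ i j, ∀ x ∈ V i ∩ V j, ∀ᶠ y in 𝓝 x, f i y / f j y = f i x / f j x) :
    FiberBundleCore X X G where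
  baseSet := V
  isOpen_baseSet := hV
  indexAt := id
  mem_baseSet_at := mem
  coordChange i j x v := v * (f i x / f j x)
  coordChange_self i x _ v := by rw [div_self', mul_one]
  continuousOn_coordChange i j p hp := by
    have fst : ∀ᶠ q : X × G in 𝓝 p, f i q.1 / f j q.1 = f i p.1 / f j p.1 :=
      continuous_fst.continuousAt.eventually (hf i j p.1 hp.1)
    have snd : ∀ᶠ q : X × G in 𝓝 p, q.2 = p.2 :=
      continuous_snd.continuousAt.eventually_mem ((isOpen_discrete {p.2}).mem_nhds rfl)
    refine (continuousAt_const (y := p.2 * (f i p.1 / f j p.1)) |>.congr ?_).continuousWithinAt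
    filter_upwards [fst, snd] with q hfst hsnd
    rw [hfst, hsnd]
  coordChange_comp i j k x _ v := by rw [mul_assoc, div_mul_div_cancel]

theorem exists_eventually_div_eq [SimplyConnectedSpace X] [LocallyPathConnectedSpace X]
    (V : X → Set X) (hV : ∀ i, IsOpen (V i)) (mem : ∀ i, i ∈ V i) (f : X → X → G)
    (hf : ∀ i j, ∀ x ∈ V i ∩ V j, ∀ᶠ y in 𝓝 x, f i y / f j y = f i x / f j x) (x₀ : X) (g₀ : G) :
    ∃ F : X → G, F x₀ = g₀ ∧ ∀ i, ∀ x ∈ V i, ∀ᶠ y in 𝓝 x, F y / f i y = F x / f i x := by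
  let _ : TopologicalSpace G := ⊥
  have : DiscreteTopology G := ⟨rfl⟩
  let Z := transitionBundle V hV mem f hf
  have covering : IsCoveringMap (Bundle.TotalSpace.proj : Z.TotalSpace → X) :=
    FiberBundle.isCoveringMap
  obtain ⟨s, ⟨s_base, s_proj⟩, -⟩ := covering.existsUnique_continuousMap_lifts
    (ContinuousMap.id X) x₀ (⟨x₀, g₀ / f x₀ x₀⟩ : Z.TotalSpace) rfl
  have proj (x : X) : (s x).proj = x := congrFun s_proj x
  let v (x : X) : G := (s x).snd
  let F (x : X) : G := v x * f (s x).proj (s x).proj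
  have localTriv_eq (i x : X) : (Z.localTriv i (s x)).2 = F x / f i x := by
    change v x * (f (s x).proj (s x).proj / f i (s x).proj)
      = v x * f (s x).proj (s x).proj / f i x
    rw [proj, mul_div_assoc]
  refine ⟨F, ?_, fun i x hx => ?_⟩
  · have v_base : v x₀ = g₀ / f x₀ x₀ := congrArg (fun t : Z.TotalSpace => (t.snd : G)) s_base
    change v x₀ * f (s x₀).proj (s x₀).proj = g₀
    rw [v_base, proj, div_mul_cancel]
  · simp only [← localTriv_eq]
    have source : s x ∈ (Z.localTriv i).source := by
      rw [(Z.localTriv i).mem_source]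
      change (s x).proj ∈ V i
      rwa [proj]
    have : ContinuousAt (fun y => (Z.localTriv i (s y)).2) x :=
      continuous_snd.continuousAt.comp
        (((Z.localTriv i).continuousAt source).comp s.continuous.continuousAt)
    exact this.eventually_mem ((isOpen_discrete {_}).mem_nhds rfl)

end Cocycle

/-! ### Linear differential equations in a Banach algebra -/

section Frame

open scoped NNReal

variable {A : Type*} [NormedRing A]

theorem isPicardLindelof_mul_right {a : ℝ → A} {s₀ ε : ℝ} {C : ℝ≥0}
    (mem : s₀ ∈ Set.Icc (s₀ - ε) (s₀ + ε)) (cont : ContinuousOn a (Set.Icc (s₀ - ε) (s₀ + ε)))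
    (bound : ∀ s ∈ Set.Icc (s₀ - ε) (s₀ + ε), ‖a s‖ ≤ C)
    (small : (‖(1 : A)‖ + 1) * C * ε ≤ 1) :
    IsPicardLindelof (fun s x => x * a s) (⟨s₀, mem⟩ : Set.Icc (s₀ - ε) (s₀ + ε)) (1 : A) 1 0
      ((‖(1 : A)‖₊ + 1) * C) C where
  lipschitzOnWith s hs := LipschitzOnWith.of_dist_le_mul fun x _ y _ => by
    rw [dist_eq_norm, dist_eq_norm, ← sub_mul, mul_comm (C : ℝ)]
    exact (norm_mul_le _ _).trans (mul_le_mul_of_nonneg_left (bound s hs) (norm_nonneg _))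
  continuousOn x _ := continuousOn_const.mul cont
  norm_le s hs x hx := by
    have norm_x : ‖x‖ ≤ ‖(1 : A)‖ + 1 :=
      norm_le_norm_add_const_of_dist_le (by simpa using hx)
    exact (norm_mul_le _ _).trans
      (mul_le_mul norm_x (bound s hs) (norm_nonneg _) ((norm_nonneg x).trans norm_x))
  mul_max_le := by simpa using small

variable [NormedAlgebra ℝ A]

theorem exists_hasDerivAt_mul_right [CompleteSpace A] {a : ℝ → A} {s₀ : ℝ}
    (ha : ∀ᶠ s in 𝓝 s₀, ContinuousAt a s) :
    ∃ φ : ℝ → A, ∀ᶠ s in 𝓝 s₀, HasDerivAt φ (φ s * a s) s ∧ IsUnit (φ s) := by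
  obtain ⟨C, hC⟩ : ∃ C : ℝ≥0, ∀ᶠ s in 𝓝 s₀, ‖a s‖ ≤ C :=
    ⟨‖a s₀‖₊ + 1, ha.self_of_nhds.norm.eventually_le_const (lt_add_one ‖a s₀‖)⟩
  have small : ∀ᶠ ε : ℝ in 𝓝 0, (‖(1 : A)‖ + 1) * C * ε ≤ 1 :=
    (continuous_const.mul continuous_id).continuousAt.eventually_le_const (by simp)
  obtain ⟨δ, hδ, near⟩ := Metric.nhds_basis_closedBall.eventually_iff.1 (ha.and hC)
  obtain ⟨ε, hε, le, small⟩ : ∃ ε : ℝ, 0 < ε ∧ ε ≤ δ ∧ (‖(1 : A)‖ + 1) * C * ε ≤ 1 := by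
    have := (Ioc_mem_nhdsGT hδ : Set.Ioc 0 δ ∈ 𝓝[>] (0 : ℝ))
    obtain ⟨ε, hε, small⟩ := ((Filter.eventually_of_mem this fun ε h => h).and
      (small.filter_mono nhdsWithin_le_nhds)).exists
    exact ⟨ε, hε.1, hε.2, small⟩
  replace near {s : ℝ} (hs : s ∈ Set.Icc (s₀ - ε) (s₀ + ε)) : ContinuousAt a s ∧ ‖a s‖ ≤ C :=
    near (Metric.closedBall_subset_closedBall le (Real.closedBall_eq_Icc ▸ hs))
  have mem : s₀ ∈ Set.Icc (s₀ - ε) (s₀ + ε) := ⟨by linarith, by linarith⟩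
  obtain ⟨φ, init, hφ⟩ := (isPicardLindelof_mul_right mem
    (fun s hs => (near hs).1.continuousWithinAt) (fun s hs => (near hs).2)
    small).exists_eq_forall_mem_Icc_hasDerivWithinAt₀
  have deriv : ∀ᶠ s in 𝓝 s₀, HasDerivAt φ (φ s * a s) s := by
    filter_upwards [Ioo_mem_nhds (sub_lt_self s₀ hε) (lt_add_of_pos_right s₀ hε)] with s hs
    exact (hφ s (Set.Ioo_subset_Icc_self hs)).hasDerivAt (Icc_mem_nhds hs.1 hs.2)
  have unit : ∀ᶠ s in 𝓝 s₀, IsUnit (φ s) :=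
    deriv.self_of_nhds.continuousAt.eventually_mem (Units.isOpen.mem_nhds (by
      change IsUnit (φ s₀)
      exact init ▸ isUnit_one))
  exact ⟨φ, deriv.and unit⟩

variable {E : Type*} [NormedAddCommGroup E] [NormedSpace ℝ E]

/-- The equation `dΨ = Ψ ξ π` on `S`, where the functional `π` is regarded as a `1`-form. -/
def IsFrame (S : Set E) (π : E →L[ℝ] ℝ) (ξ Ψ : E → A) : Prop :=
  ∀ p ∈ S, HasFDerivAt Ψ (π.smulRight (Ψ p * ξ p)) p

theorem IsFrame.mono {S T : Set E} {π : E →L[ℝ] ℝ} {ξ Ψ : E → A} (hΨ : IsFrame T π ξ Ψ)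
    (h : S ⊆ T) : IsFrame S π ξ Ψ := fun p hp => hΨ p (h hp)

theorem IsFrame.hasFDerivAt_mul_inverse [CompleteSpace A] {S : Set E} {π : E →L[ℝ] ℝ}
    {ξ Φ Ψ : E → A} (hΦ : IsFrame S π ξ Φ) (hΨ : IsFrame S π ξ Ψ) {p : E} (hp : p ∈ S)
    (unit : IsUnit (Ψ p)) :
    HasFDerivAt (fun p => Φ p * Ring.inverse (Ψ p)) (0 : E →L[ℝ] A) p := by
  obtain ⟨u, hu⟩ := unit
  have inverse : HasFDerivAt Ring.inverse (-ContinuousLinearMap.mulLeftRight ℝ A ↑u⁻¹ ↑u⁻¹)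
      (Ψ p) := hu ▸ hasFDerivAt_ringInverse u
  refine ((hΦ p hp).mul' (inverse.comp p (hΨ p hp))).congr_fderiv ?_
  ext v
  simp [← hu, ← mul_assoc]

theorem IsFrame.mul_inverse_eq [CompleteSpace A] {S : Set E} (hS : IsOpen S)
    (conn : IsPreconnected S) {π : E →L[ℝ] ℝ} {ξ Φ Ψ : E → A} (hΦ : IsFrame S π ξ Φ)
    (hΨ : IsFrame S π ξ Ψ) (unit : ∀ p ∈ S, IsUnit (Ψ p)) {p q : E} (hp : p ∈ S) (hq : q ∈ S) :
    Φ p * Ring.inverse (Ψ p) = Φ q * Ring.inverse (Ψ q) :=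
  have deriv {p : E} (hp : p ∈ S) := hΦ.hasFDerivAt_mul_inverse hΨ hp (unit p hp)
  hS.is_const_of_fderiv_eq_zero conn
    (fun _ hp => (deriv hp).differentiableAt.differentiableWithinAt)
    (fun _ hp => (deriv hp).fderiv) hp hq

theorem IsFrame.eqOn [CompleteSpace A] {S : Set E} (hS : IsOpen S) (conn : IsPreconnected S)
    {π : E →L[ℝ] ℝ} {ξ Φ Ψ : E → A} (hΦ : IsFrame S π ξ Φ) (hΨ : IsFrame S π ξ Ψ)
    (unit : ∀ p ∈ S, IsUnit (Ψ p)) {p₀ : E} (hp₀ : p₀ ∈ S) (init : Φ p₀ = Ψ p₀) :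
    Set.EqOn Φ Ψ S := fun p hp => by
  have eq_one := hΦ.mul_inverse_eq hS conn hΨ unit hp hp₀
  rw [init, Ring.mul_inverse_cancel _ (unit _ hp₀)] at eq_one
  rw [← mul_one (Φ p), ← Ring.inverse_mul_cancel _ (unit p hp), ← mul_assoc, eq_one, one_mul]

theorem IsFrame.contDiffOn {S : Set E} (hS : IsOpen S) {π : E →L[ℝ] ℝ} {ξ Ψ : E → A}
    (hξ : ContDiffOn ℝ ∞ ξ S) (hΨ : IsFrame S π ξ Ψ) : ContDiffOn ℝ ∞ Ψ S := by
  rw [contDiffOn_infty]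
  intro n
  induction n with
  | zero => exact contDiffOn_zero.2 fun p hp => (hΨ p hp).continuousAt.continuousWithinAt
  | succ n ih =>
    rw [Nat.cast_add, Nat.cast_one, contDiffOn_succ_iff_fderiv_of_isOpen hS]
    refine ⟨fun p hp => (hΨ p hp).differentiableAt.differentiableWithinAt, by simp, ?_⟩
    have fderiv_smooth : ContDiffOn ℝ n
        (fun p => ContinuousLinearMap.smulRightL ℝ E A π (Ψ p * ξ p)) S :=
      (ContinuousLinearMap.contDiff _).comp_contDiffOn (ih.mul (hξ.of_le (mod_cast le_top)))
    exact fderiv_smooth.congr fun p hp => (hΨ p hp).fderiv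

/-- `ξ` is constant along the segments in `S` on which `π` is constant. -/
def FactorsLocally {F : Type*} (S : Set E) (π : E →L[ℝ] ℝ) (ξ : E → F) : Prop :=
  ∀ p q : E, segment ℝ p q ⊆ S → π p = π q → ξ p = ξ q

theorem FactorsLocally.exists_isFrame_ball [CompleteSpace A] {S : Set E} (hS : IsOpen S)
    {π : E →L[ℝ] ℝ} {e : E} (he : π e = 1) {ξ : E → A} (hξ : ContinuousOn ξ S)
    (factors : FactorsLocally S π ξ) {p₀ : E} (hp₀ : p₀ ∈ S) :
    ∃ r > 0, ∃ Φ : E → A, IsFrame (Metric.ball p₀ r) π ξ Φ ∧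
      ∀ p ∈ Metric.ball p₀ r, IsUnit (Φ p) := by
  obtain ⟨δ, hδ, ball_subset⟩ := Metric.isOpen_iff.1 hS p₀ hp₀
  -- `γ` is the section of `π` through `p₀` in the direction `e`.
  obtain ⟨γ, hγ⟩ : ∃ γ : ℝ → E, ∀ s, γ s = p₀ + (s - π p₀) • e := ⟨_, fun _ => rfl⟩
  have γ_cont : Continuous γ := by rw [funext hγ]; fun_prop
  have γ_base : γ (π p₀) = p₀ := by rw [hγ, sub_self, zero_smul, add_zero]
  have π_γ (s : ℝ) : π (γ s) = s := by simp [hγ, he]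
  have γ_mem : ∀ᶠ s in 𝓝 (π p₀), γ s ∈ Metric.ball p₀ δ :=
    γ_cont.continuousAt.eventually_mem (γ_base.symm ▸ Metric.ball_mem_nhds p₀ hδ)
  obtain ⟨φ, hφ⟩ := exists_hasDerivAt_mul_right (a := ξ ∘ γ) (s₀ := π p₀) (γ_mem.mono fun s hs =>
    (hξ.continuousAt (hS.mem_nhds (ball_subset hs))).comp γ_cont.continuousAt)
  have near : ∀ᶠ p in 𝓝 p₀, HasFDerivAt (φ ∘ π) (π.smulRight (φ (π p) * ξ p)) p ∧
      IsUnit (φ (π p)) := by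
    filter_upwards [Metric.ball_mem_nhds p₀ hδ, π.continuous.continuousAt.eventually γ_mem,
      π.continuous.continuousAt.eventually hφ] with p hp γ_mem hφ
    have ξ_eq : ξ (γ (π p)) = ξ p :=
      factors _ _ (((convex_ball p₀ δ).segment_subset γ_mem hp).trans ball_subset) (π_γ _)
    refine ⟨(hφ.1.hasFDerivAt.comp p π.hasFDerivAt).congr_fderiv ?_, hφ.2⟩
    ext v
    simp [ξ_eq]
  obtain ⟨r, hr, near⟩ := Metric.eventually_nhds_iff_ball.1 near
  exact ⟨r, hr, φ ∘ π, fun p hp => (near p hp).1, fun p hp => (near p hp).2⟩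

theorem exists_isFrame_of_local [CompleteSpace A] {S : Set E} (hS : IsOpen S)
    [SimplyConnectedSpace S] {π : E →L[ℝ] ℝ} {ξ : E → A}
    (loc : ∀ p₀ ∈ S, ∃ r > 0, ∃ Φ : E → A, IsFrame (Metric.ball p₀ r) π ξ Φ ∧
      ∀ p ∈ Metric.ball p₀ r, IsUnit (Φ p)) {p₀ : E} (hp₀ : p₀ ∈ S) :
    ∃ Ψ : E → A, Ψ p₀ = 1 ∧ IsFrame S π ξ Ψ ∧ ∀ p ∈ S, IsUnit (Ψ p) := by
  classical
  choose r hr Φ hΦ unit using fun i : S => loc i i.2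
  have : LocallyPathConnectedSpace S := hS.locallyPathConnectedSpace
  let V (i : S) : Set S := Subtype.val ⁻¹' Metric.ball (i : E) (r i)
  have V_open (i : S) : IsOpen (V i) := Metric.isOpen_ball.preimage continuous_subtype_val
  have V_mem (i : S) : i ∈ V i := Metric.mem_ball_self (hr i)
  obtain ⟨f, hf⟩ : ∃ f : S → S → Aˣ, ∀ i, ∀ x ∈ V i, (f i x : A) = Φ i x :=
    ⟨fun i x => if h : IsUnit (Φ i x) then h.unit else 1, fun i x hx => by
      simp only [dif_pos (unit i x hx), IsUnit.unit_spec]⟩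
  have transition (i j : S) (x : S) (hx : x ∈ V i ∩ V j) :
      ((f i x / f j x : Aˣ) : A) = Φ i x * Ring.inverse (Φ j x) := by
    rw [div_eq_mul_inv, Units.val_mul, ← Ring.inverse_unit, hf i x hx.1, hf j x hx.2]
  obtain ⟨F, F_base, hF⟩ := exists_eventually_div_eq V V_open V_mem f (fun i j x hx => by
    filter_upwards [((V_open i).inter (V_open j)).mem_nhds hx] with y hy
    ext
    rw [transition i j y hy, transition i j x hx]
    exact ((hΦ i).mono Set.inter_subset_left).mul_inverse_eq
      (Metric.isOpen_ball.inter Metric.isOpen_ball)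
      ((convex_ball (i : E) (r i)).inter (convex_ball (j : E) (r j))).isPreconnected
      ((hΦ j).mono Set.inter_subset_right) (fun p hp => unit j p hp.2) hy hx) ⟨p₀, hp₀⟩ 1
  obtain ⟨Ψ, hΨ⟩ : ∃ Ψ : E → A, ∀ x : S, Ψ x = F x :=
    ⟨fun p => if h : p ∈ S then (F ⟨p, h⟩ : A) else 0, fun x => dif_pos x.2⟩
  refine ⟨Ψ, by rw [hΨ ⟨p₀, hp₀⟩, F_base, Units.val_one], fun p hp => ?_,
    fun p hp => hΨ ⟨p, hp⟩ ▸ (F _).isUnit⟩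
  obtain ⟨i, rfl⟩ : ∃ i : S, (i : E) = p := ⟨⟨p, hp⟩, rfl⟩
  have eq : ∀ᶠ y in 𝓝 (i : E), Ψ y = ↑(F i / f i i) * Φ i y := by
    rw [← hS.isOpenEmbedding_subtypeVal.map_nhds_eq i, Filter.eventually_map]
    filter_upwards [hF i i (V_mem i), (V_open i).mem_nhds (V_mem i)] with y hy hyV
    rw [hΨ, ← hy, ← hf i y hyV, ← Units.val_mul, div_mul_cancel]
  refine (((hΦ i i (V_mem i)).const_mul _).congr_of_eventuallyEq eq).congr_fderiv ?_
  ext v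
  simp [eq.self_of_nhds, mul_assoc]

theorem FactorsLocally.exists_isFrame [CompleteSpace A] {S : Set E} (hS : IsOpen S)
    [SimplyConnectedSpace S] {π : E →L[ℝ] ℝ} {e : E} (he : π e = 1) {ξ : E → A}
    (hξ : ContinuousOn ξ S) (factors : FactorsLocally S π ξ) {p₀ : E} (hp₀ : p₀ ∈ S) :
    ∃ Ψ : E → A, Ψ p₀ = 1 ∧ IsFrame S π ξ Ψ ∧ ∀ p ∈ S, IsUnit (Ψ p) :=
  exists_isFrame_of_local hS (fun _ hp => factors.exists_isFrame_ball hS he hξ hp) hp₀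

end Frame

theorem factorsLocally_of_fderiv {E F : Type*} [NormedAddCommGroup E] [NormedSpace ℝ E]
    [NormedAddCommGroup F] [NormedSpace ℝ F] {S : Set E} (hS : IsOpen S) {π : E →L[ℝ] ℝ}
    {ξ : E → F} (hξ : DifferentiableOn ℝ ξ S)
    (deriv : ∀ p ∈ S, ∀ v, π v = 0 → fderiv ℝ ξ p v = 0) : FactorsLocally S π ξ := by
  intro p q segment_subset hπ
  have mem {t : ℝ} (ht : t ∈ Set.Icc (0 : ℝ) 1) : p + t • (q - p) ∈ S :=
    segment_subset (segment_eq_image' ℝ p q ▸ Set.mem_image_of_mem _ ht)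
  have along {t : ℝ} (ht : t ∈ Set.Icc (0 : ℝ) 1) :
      HasDerivAt (fun t : ℝ => ξ (p + t • (q - p))) 0 t := by
    have line : HasDerivAt (fun t : ℝ => p + t • (q - p)) (q - p) t := by
      simpa using ((hasDerivAt_id t).smul_const (q - p)).const_add p
    have chain := ((hξ.differentiableAt (hS.mem_nhds (mem ht))).hasFDerivAt).comp_hasDerivAt t line
    rwa [deriv _ (mem ht) _ (by rw [map_sub, hπ, sub_self])] at chain
  have const := constant_of_has_deriv_right_zero
    (fun t ht => (along ht).continuousAt.continuousWithinAt)
    (fun t ht => (along (Set.Ico_subset_Icc_self ht)).hasDerivWithinAt) 1 ⟨zero_le_one, le_rfl⟩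
  simpa using const.symm

theorem exists_isFrame_mem {E A : Type*} [NormedAddCommGroup E] [NormedSpace ℝ E] [NormedRing A]
    [NormedAlgebra ℝ A] [CompleteSpace A] {B : Subalgebra ℝ A} (hB : IsClosed (B : Set A))
    {S : Set E} (hS : IsOpen S) [SimplyConnectedSpace S] {π : E →L[ℝ] ℝ} {e : E} (he : π e = 1)
    {ξ : E → A} (hξ : ContinuousOn ξ S) (factors : FactorsLocally S π ξ) (mem : ∀ p ∈ S, ξ p ∈ B)
    {p₀ : E} (hp₀ : p₀ ∈ S) :
    ∃ Ψ : E → A, Ψ p₀ = 1 ∧ IsFrame S π ξ Ψ ∧ ∀ p ∈ S, IsUnit (Ψ p) ∧ Ψ p ∈ B := by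
  classical
  have : CompleteSpace B := hB.isComplete.completeSpace_coe
  obtain ⟨ζ, hζ⟩ : ∃ ζ : E → B, ∀ p ∈ S, (ζ p : A) = ξ p :=
    ⟨fun p => if h : p ∈ S then ⟨ξ p, mem p h⟩ else 0, fun p h => by simp only [dif_pos h]⟩
  have ζ_cont : ContinuousOn ζ S :=
    Topology.IsInducing.subtypeVal.continuousOn_iff.2 (hξ.congr hζ)
  have ζ_factors : FactorsLocally S π ζ := fun p q hpq hπ => by
    ext
    rw [hζ p (hpq (left_mem_segment ℝ p q)), hζ q (hpq (right_mem_segment ℝ p q)),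
      factors p q hpq hπ]
  obtain ⟨Φ, init, hΦ, unit⟩ := ζ_factors.exists_isFrame hS he ζ_cont hp₀
  refine ⟨fun p => Φ p, congrArg Subtype.val init, fun p hp => ?_,
    fun p hp => ⟨(unit p hp).map B.val, (Φ p).2⟩⟩
  refine (B.toSubmodule.subtypeL.hasFDerivAt.comp p (hΦ p hp)).congr_fderiv ?_
  ext v
  change π v • ((Φ p : A) * (ζ p : A)) = π v • ((Φ p : A) * ξ p)
  rw [hζ p hp]

/-! ### Dilations of Laurent series -/

section Dilation

variable {A : Type*} [NormedRing A] [NormedAlgebra ℝ A] {s : ℝ}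
  {f g f' g' : lp (fun _ : ℤ => A) 1}

/-- `g(λ) = f(sλ)`, in terms of coefficients. It is a relation since `f(sλ)` need not be absolutely
convergent on the unit circle. -/
def IsDilation (s : ℝ) (f g : lp (fun _ : ℤ => A) 1) : Prop := ∀ k, g k = s ^ k • f k

theorem IsDilation.unique (h : IsDilation s f g) (h' : IsDilation s f g') : g = g' := by
  ext k
  rw [h, h']

theorem IsDilation.add (h : IsDilation s f g) (h' : IsDilation s f' g') :
    IsDilation s (f + f') (g + g') := fun k => by
  simp only [lp.coeFn_add, Pi.add_apply, h k, h' k, smul_add]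

theorem isDilation_single (s : ℝ) (k : ℤ) (X : A) :
    IsDilation s (lp.single 1 k X) (lp.single 1 k (s ^ k • X)) := fun l => by
  rcases eq_or_ne l k with rfl | hl
  · simp only [lp.single_apply_self]
  · simp only [lp.single_apply_ne _ _ _ hl, smul_zero]

theorem exists_clm_isDilation {S : Set ℤ} {K : ℝ} (hK : ∀ k ∈ S, |s ^ k| ≤ K) :
    ∃ L : lp (fun _ : ℤ => A) 1 →L[ℝ] lp (fun _ : ℤ => A) 1,
      ∀ f ∈ powersIn S, IsDilation s f (L f) := by
  classical
  refine ⟨lp.mapCLM 1 (fun k => if k ∈ S then s ^ k • .id ℝ A else 0) (abs_nonneg K) fun k => ?_,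
    fun f hf k => ?_⟩
  · split_ifs with hk
    · exact (norm_smul_le _ _).trans ((mul_le_of_le_one_right (norm_nonneg _)
        ContinuousLinearMap.norm_id_le).trans ((hK k hk).trans (le_abs_self K)))
    · simp only [norm_zero, abs_nonneg]
  · rw [lp.mapCLM_apply_coe]
    split_ifs with hk
    · rfl
    · rw [hf k hk, map_zero, smul_zero]

theorem abs_zpow_le_of_mem_Iic (hs : 1 ≤ |s|) {k n : ℤ} (hk : k ∈ Set.Iic n) :
    |s ^ k| ≤ |s| ^ n :=
  (abs_zpow s k).trans_le (zpow_le_zpow_right₀ hs hk)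

theorem abs_zpow_le_of_mem_Ici (hs : s ≠ 0) (le : |s| ≤ 1) {k n : ℤ} (hk : k ∈ Set.Ici n) :
    |s ^ k| ≤ |s| ^ n :=
  (abs_zpow s k).trans_le (zpow_le_zpow_right_of_le_one₀ (abs_pos.2 hs) le hk)

variable [CompleteSpace A]

theorem isDilation_one (s : ℝ) : IsDilation s (1 : lp (fun _ : ℤ => A) 1) 1 := by
  have h := isDilation_single s 0 (1 : A)
  rwa [zpow_zero, one_smul] at h

theorem IsDilation.mul (hs : s ≠ 0) (h : IsDilation s f g) (h' : IsDilation s f' g') :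
    IsDilation s (f * f') (g * g') := fun n => by
  rw [mul_coeff, mul_coeff, ← (summable_conv f f' n).tsum_const_smul]
  exact tsum_congr fun k => by rw [h, h', smul_mul_smul_comm, ← zpow_add₀ hs, add_sub_cancel]

/-- The graph of the dilation by `s`. -/
def dilationGraph (A : Type*) [NormedRing A] [NormedAlgebra ℝ A] [CompleteSpace A] (hs : s ≠ 0) :
    Subalgebra ℝ (lp (fun _ : ℤ => A) 1 × lp (fun _ : ℤ => A) 1) where
  carrier := {q | IsDilation s q.1 q.2}
  mul_mem' := IsDilation.mul hs
  add_mem' := IsDilation.add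
  algebraMap_mem' c := by
    rw [Algebra.algebraMap_eq_smul_one]
    exact fun k => (congrArg (c • ·) (isDilation_one s k)).trans (smul_comm _ _ _)

theorem isClosed_dilationGraph (hs : s ≠ 0) :
    IsClosed (dilationGraph A hs : Set (lp (fun _ : ℤ => A) 1 × lp (fun _ : ℤ => A) 1)) := by
  have coeff_cont (k : ℤ) : Continuous fun f : lp (fun _ : ℤ => A) 1 => f k :=
    (lp.evalCLM ℝ (fun _ : ℤ => A) 1 k).continuous
  simp only [dilationGraph, IsDilation, Subalgebra.coe_mk, Set.ofPred_forall]
  exact isClosed_iInter fun k => isClosed_eq ((coeff_cont k).comp continuous_snd)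
    (((coeff_cont k).comp continuous_fst).const_smul (s ^ k))

variable {E : Type*} [NormedAddCommGroup E] [NormedSpace ℝ E] {S : Set E} {π : E →L[ℝ] ℝ}

theorem IsFrame.exists_isDilation (hS : IsOpen S) [SimplyConnectedSpace S] {e : E} (he : π e = 1)
    (hs : s ≠ 0) {ξ ζ Ψ : E → lp (fun _ : ℤ => A) 1} (hξ : ContinuousOn ξ S)
    (hζ : ContinuousOn ζ S) (factors : FactorsLocally S π ξ)
    (dil : ∀ p ∈ S, IsDilation s (ξ p) (ζ p)) {p₀ : E} (hp₀ : p₀ ∈ S) (hΨ : IsFrame S π ξ Ψ)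
    (init : Ψ p₀ = 1) :
    ∃ Φ : E → lp (fun _ : ℤ => A) 1, IsFrame S π ζ Φ ∧ ∀ p ∈ S, IsDilation s (Ψ p) (Φ p) := by
  have ζ_factors : FactorsLocally S π ζ := fun p q hpq hπ => by
    refine (dil p (hpq (left_mem_segment ℝ p q))).unique ?_
    rw [factors p q hpq hπ]
    exact dil q (hpq (right_mem_segment ℝ p q))
  obtain ⟨Θ, Θ_init, hΘ, Θ_mem⟩ := exists_isFrame_mem (isClosed_dilationGraph hs) hS he
    (hξ.prodMk hζ) (fun p q hpq hπ => Prod.ext (factors p q hpq hπ) (ζ_factors p q hpq hπ)) dil hp₀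
  have fst : IsFrame S π ξ fun p => (Θ p).1 := fun p hp =>
    (hΘ p hp).fst.congr_fderiv (by ext1; rfl)
  have snd : IsFrame S π ζ fun p => (Θ p).2 := fun p hp =>
    (hΘ p hp).snd.congr_fderiv (by ext1; rfl)
  have eq : Set.EqOn Ψ (fun p => (Θ p).1) S :=
    hΨ.eqOn hS (isPreconnected_iff_preconnectedSpace.2 inferInstance) fst
      (fun p hp => (Θ_mem p hp).1.map (RingHom.fst _ _)) hp₀ (init.trans (by rw [Θ_init]; rfl))
  exact ⟨fun p => (Θ p).2, snd, fun p hp => eq hp ▸ (Θ_mem p hp).2⟩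

end Dilation

/-! ### Analytic loops -/

section Laurent

theorem zpow_le_zpow_add_zpow {a b x : ℝ} (ha : 0 < a) (hax : a ≤ x) (hxb : x ≤ b) (k : ℤ) :
    x ^ k ≤ a ^ k + b ^ k := by
  have hx : 0 < x := ha.trans_le hax
  rcases le_total 0 k with hk | hk
  · exact (zpow_le_zpow_left₀ hk hx.le hxb).trans (le_add_of_nonneg_left (zpow_pos ha k).le)
  · have inv_le : (x ^ k)⁻¹ ≥ (a ^ k)⁻¹ := by
      rw [← zpow_neg, ← zpow_neg]
      exact zpow_le_zpow_left₀ (neg_nonneg.2 hk) ha.le hax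
    exact ((inv_le_inv₀ (zpow_pos ha k) (zpow_pos hx k)).1 inv_le).trans
      (le_add_of_nonneg_right (zpow_pos (hx.trans_le hxb) k).le)

variable {E : Type*} [NormedAddCommGroup E] [NormedSpace ℂ E]

theorem circleIntegral_eq_of_differentiableOn_compl {F : ℂ → E} (hF : DifferentiableOn ℂ F {0}ᶜ)
    {r R : ℝ} (hr : 0 < r) (hR : 0 < R) : (∮ z in C(0, r), F z) = ∮ z in C(0, R), F z := by
  wlog le : r ≤ R generalizing r R
  · exact (this hR hr (le_of_not_ge le)).symm
  refine (Complex.circleIntegral_eq_of_differentiable_on_annulus_off_countable hr le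
    Set.countable_empty (hF.continuousOn.mono ?_) fun z hz => ?_).symm
  · rintro z hz rfl
    exact hz.2 (Metric.mem_ball_self hr)
  · refine hF.differentiableAt (isOpen_compl_singleton.mem_nhds ?_)
    rintro rfl
    exact hz.1.2 (Metric.mem_closedBall_self hr.le)

variable [CompleteSpace E] {c : ℤ → E}

theorem differentiableOn_laurent (h : ∀ s : ℝ, 0 < s → Summable fun k => s ^ k * ‖c k‖) :
    DifferentiableOn ℂ (fun z : ℂ => ∑' k, z ^ k • c k) {0}ᶜ := by
  intro z₀ hz₀
  have norm_pos : 0 < ‖z₀‖ := norm_pos_iff.2 hz₀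
  obtain ⟨U, hU⟩ : ∃ U : Set ℂ, U = {z | ‖z₀‖ / 2 < ‖z‖ ∧ ‖z‖ < 2 * ‖z₀‖} := ⟨_, rfl⟩
  have U_open : IsOpen U := hU ▸
    (isOpen_lt continuous_const continuous_norm).inter (isOpen_lt continuous_norm continuous_const)
  have mem_U : z₀ ∈ U := hU ▸ ⟨by linarith, by linarith⟩
  have diff : DifferentiableOn ℂ (fun z => ∑' k, z ^ k • c k) U := by
    refine Complex.differentiableOn_tsum_of_summable_norm
      ((h (‖z₀‖ / 2) (by positivity)).add (h (2 * ‖z₀‖) (by positivity)))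
      (fun k z hz => ?_) U_open (fun k z hz => ?_) <;> rw [hU] at hz
    · have : z ≠ 0 := norm_pos_iff.1 ((half_pos norm_pos).trans hz.1)
      exact ((differentiableAt_zpow.2 (Or.inl this)).smul_const _).differentiableWithinAt
    · rw [norm_smul, norm_zpow, ← add_mul]
      gcongr
      exact zpow_le_zpow_add_zpow (half_pos norm_pos) hz.1.le hz.2.le k
  exact (diff.differentiableAt (U_open.mem_nhds mem_U)).differentiableWithinAt

theorem zpow_mul_norm_coeff_le (hc : Summable fun k => ‖c k‖) {F : ℂ → E}
    (hF : DifferentiableOn ℂ F {0}ᶜ) (eq : ∀ z : ℂ, ‖z‖ = 1 → F z = ∑' k, z ^ k • c k) {ρ C : ℝ}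
    (hρ : 0 < ρ) (bound : ∀ z : ℂ, ‖z‖ = ρ → ‖F z‖ ≤ C) (k : ℤ) : ρ ^ k * ‖c k‖ ≤ C := by
  have diff : DifferentiableOn ℂ (fun z => z ^ (-k - 1) • F z) {0}ᶜ := fun z hz =>
    (differentiableAt_zpow.2 (Or.inl hz)).differentiableWithinAt.smul (hF z hz)
  have integral : (∮ z in C(0, ρ), z ^ (-k - 1) • F z) = (2 * Real.pi * Complex.I : ℂ) • c k :=
    calc (∮ z in C(0, ρ), z ^ (-k - 1) • F z)
      _ = ∮ z in C(0, 1), z ^ (-k - 1) • F z :=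
        circleIntegral_eq_of_differentiableOn_compl diff hρ one_pos
      _ = ∮ z in C(0, 1), z ^ (-k - 1) • ∑' k, z ^ k • c k :=
        circleIntegral.integral_congr zero_le_one fun z hz => by
          simp only [eq z (by simpa using hz)]
      _ = (2 * Real.pi * Complex.I : ℂ) • c k := circleIntegral_laurent hc k
  have estimate : ‖∮ z in C(0, ρ), z ^ (-k - 1) • F z‖ ≤ 2 * Real.pi * ρ * (ρ ^ (-k - 1) * C) := by
    refine circleIntegral.norm_integral_le_of_norm_le_const hρ.le fun z hz => ?_
    have norm_z : ‖z‖ = ρ := by simpa using hz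
    rw [norm_smul, norm_zpow, norm_z]
    gcongr
    exact bound z norm_z
  have norm_two_pi_I : ‖(2 * Real.pi * Complex.I : ℂ)‖ = 2 * Real.pi := by
    simp [Real.pi_pos.le]
  rw [integral, norm_smul, norm_two_pi_I, mul_assoc (2 * Real.pi),
    mul_le_mul_iff_right₀ (by positivity)] at estimate
  calc ρ ^ k * ‖c k‖
    _ ≤ ρ ^ k * (ρ * (ρ ^ (-k - 1) * C)) := by gcongr
    _ = ρ ^ (k + 1 + (-k - 1)) * C := by rw [zpow_add₀ hρ.ne', zpow_add_one₀ hρ.ne']; ring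
    _ = C := by rw [show k + 1 + (-k - 1) = 0 by ring, zpow_zero, one_mul]

end Laurent

theorem norm_complexify (X : M2) : ‖complexify X‖ = ‖X‖ := by
  simp only [Matrix.linfty_opNorm_def, complexify_apply, Complex.nnnorm_real]

theorem differentiableOn_matrix_iff {F : ℂ → C2} {s : Set ℂ} :
    DifferentiableOn ℂ F s ↔ ∀ i j, DifferentiableOn ℂ (fun z => F z i j) s := by
  rw [← (Matrix.ofLinearEquiv ℂ).toContinuousLinearEquiv.symm.comp_differentiableOn_iff,
    differentiableOn_pi]
  exact forall_congr' fun i => differentiableOn_pi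

theorem extendsAnalytically_iff {γ : Loop} : ExtendsAnalytically γ ↔
    ∃ F : ℂ → C2, DifferentiableOn ℂ F {0}ᶜ ∧ ∀ z : ℂ, ‖z‖ = 1 → F z = γ.eval z := by
  simp only [ExtendsAnalytically, differentiableOn_matrix_iff]

theorem ExtendsAnalytically.mul {γ δ : Loop} (hγ : ExtendsAnalytically γ)
    (hδ : ExtendsAnalytically δ) : ExtendsAnalytically (γ * δ) := by
  rw [extendsAnalytically_iff] at hγ hδ ⊢
  obtain ⟨F, hF, F_eq⟩ := hγ
  obtain ⟨G, hG, G_eq⟩ := hδ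
  exact ⟨fun z => F z * G z, hF.mul hG,
    fun z hz => by simp only [F_eq z hz, G_eq z hz, eval_mul _ _ hz]⟩

theorem ExtendsAnalytically.adj {γ : Loop} (hγ : ExtendsAnalytically γ) :
    ExtendsAnalytically (Loop.adj γ) := by
  rw [extendsAnalytically_iff] at hγ ⊢
  obtain ⟨F, hF, F_eq⟩ := hγ
  exact ⟨fun z => (F z).adjugate,
    (adjugateLin ℂ).toContinuousLinearMap.differentiable.comp_differentiableOn hF,
    fun z hz => by simp only [F_eq z hz, eval_adj _ hz]⟩

theorem extendsAnalytically_of_isDilation {γ : Loop}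
    (dil : ∀ s : ℝ, 0 < s → ∃ η, IsDilation s γ η) : ExtendsAnalytically γ := by
  refine extendsAnalytically_iff.2 ⟨fun z => ∑' k, z ^ k • complexify (γ k),
    differentiableOn_laurent fun s hs => ?_, fun z _ => rfl⟩
  obtain ⟨η, hη⟩ := dil s hs
  refine (summable_norm_coeff η).congr fun k => ?_
  rw [hη, norm_smul, norm_complexify, Real.norm_of_nonneg (zpow_pos hs k).le]

theorem zpow_mul_le_half_pow {s x C : ℝ} (hs : 0 < s) {k : ℤ} (outer : (2 * s) ^ k * x ≤ C)
    (inner : (s / 2) ^ k * x ≤ C) : s ^ k * x ≤ C * (1 / 2) ^ k.natAbs := by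
  obtain ⟨n, rfl | rfl⟩ := k.eq_nat_or_neg
  · calc s ^ (n : ℤ) * x
      _ = (2 * s) ^ (n : ℤ) * x * (1 / 2) ^ n := by
        rw [zpow_natCast, zpow_natCast, mul_pow, one_div, inv_pow]
        field_simp
      _ ≤ C * (1 / 2) ^ (n : ℤ).natAbs := by rw [Int.natAbs_natCast]; gcongr
  · calc s ^ (-n : ℤ) * x
      _ = (s / 2) ^ (-n : ℤ) * x * (1 / 2) ^ n := by
        rw [zpow_neg, zpow_neg, zpow_natCast, zpow_natCast, div_pow, one_div, inv_pow]
        field_simp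
      _ ≤ C * (1 / 2) ^ (-n : ℤ).natAbs := by rw [Int.natAbs_neg, Int.natAbs_natCast]; gcongr

theorem summable_half_pow_natAbs : Summable fun k : ℤ => (1 / 2 : ℝ) ^ k.natAbs := by
  refine Summable.of_nat_of_neg ?_ ?_ <;> simpa using summable_geometric_two

theorem continuousAt_of_dominated_coeff {X ι E : Type*} [TopologicalSpace X]
    [NormedAddCommGroup E] {f : X → lp (fun _ : ι => E) 1} {p₀ : X} {b : ι → ℝ} (hb : Summable b)
    (cont : ∀ k, ContinuousAt (fun p => f p k) p₀) (bound : ∀ᶠ p in 𝓝 p₀, ∀ k, ‖f p k‖ ≤ b k) :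
    ContinuousAt f p₀ := by
  rw [ContinuousAt, tendsto_iff_norm_sub_tendsto_zero]
  simp only [norm_eq_tsum_norm]
  rw [← tsum_zero]
  refine tendsto_tsum_of_dominated_convergence (hb.add hb) (fun k => ?_) ?_
  · simpa using ((cont k).sub (continuousAt_const (y := f p₀ k))).norm.tendsto
  · filter_upwards [bound] with p hp k
    rw [norm_norm]
    exact (norm_sub_le _ _).trans (add_le_add (hp k) (bound.self_of_nhds k))

section AnalyticLoops

variable {D : Set (ℝ × ℝ)} {ξ : ℝ × ℝ → Loop} {p₀ : ℝ × ℝ}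

theorem AnalyticLoops.zpow_mul_norm_le (hD : IsOpen D) (h : AnalyticLoops D ξ) {ρ : ℝ} (hρ : 0 < ρ)
    (hp₀ : p₀ ∈ D) : ∃ C, ∀ᶠ p in 𝓝 p₀, ∀ k : ℤ, ρ ^ k * ‖ξ p k‖ ≤ C := by
  obtain ⟨F, F_cont, F_diff, F_eq⟩ := h
  obtain ⟨δ, hδ, ball_subset⟩ := Metric.nhds_basis_closedBall.mem_iff.1 (hD.mem_nhds hp₀)
  have subset : Metric.closedBall p₀ δ ×ˢ Metric.sphere (0 : ℂ) ρ ⊆ D ×ˢ {0}ᶜ :=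
    Set.prod_mono ball_subset fun z hz => Metric.ne_of_mem_sphere hz hρ.ne'
  obtain ⟨C, hC⟩ := ((isCompact_closedBall p₀ δ).prod
    (isCompact_sphere (0 : ℂ) ρ)).exists_bound_of_continuousOn (F_cont.mono subset)
  refine ⟨C, ?_⟩
  filter_upwards [Metric.closedBall_mem_nhds p₀ hδ] with p hp k
  rw [← norm_complexify]
  exact zpow_mul_norm_coeff_le (ξ p).summable_norm_complexify
    (differentiableOn_matrix_iff.2 (F_diff p (ball_subset hp))) (F_eq p (ball_subset hp)) hρ
    (fun z hz => hC (p, z) ⟨hp, by simpa using hz⟩) k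

theorem AnalyticLoops.norm_dilation_le (hD : IsOpen D) (h : AnalyticLoops D ξ) {s : ℝ} (hs : 0 < s)
    (hp₀ : p₀ ∈ D) : ∃ C, ∀ᶠ p in 𝓝 p₀, ∀ k : ℤ, ‖s ^ k • ξ p k‖ ≤ C * (1 / 2) ^ k.natAbs := by
  obtain ⟨C₁, outer⟩ := h.zpow_mul_norm_le hD (mul_pos two_pos hs) hp₀
  obtain ⟨C₂, inner⟩ := h.zpow_mul_norm_le hD (half_pos hs) hp₀
  refine ⟨max C₁ C₂, ?_⟩
  filter_upwards [outer, inner] with p outer inner k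
  rw [norm_smul, Real.norm_of_nonneg (zpow_pos hs k).le]
  exact zpow_mul_le_half_pow hs ((outer k).trans (le_max_left _ _))
    ((inner k).trans (le_max_right _ _))

theorem AnalyticLoops.exists_isDilation (hD : IsOpen D) (h : AnalyticLoops D ξ)
    (hξ : ContinuousOn ξ D) {s : ℝ} (hs : 0 < s) :
    ∃ ζ : ℝ × ℝ → Loop, ContinuousOn ζ D ∧ ∀ p ∈ D, IsDilation s (ξ p) (ζ p) := by
  classical
  have summable (p) (hp : p ∈ D) : Summable fun k : ℤ => ‖s ^ k • ξ p k‖ := by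
    obtain ⟨C, hC⟩ := h.norm_dilation_le hD hs hp
    exact (summable_half_pow_natAbs.mul_left C).of_nonneg_of_le (fun _ => norm_nonneg _)
      hC.self_of_nhds
  obtain ⟨ζ, hζ⟩ : ∃ ζ : ℝ × ℝ → Loop, ∀ p ∈ D, IsDilation s (ξ p) (ζ p) :=
    ⟨fun p => if hp : p ∈ D then ⟨fun k => s ^ k • ξ p k, memℓp_gen (by simpa using summable p hp)⟩
      else 0, fun p hp k => by simp only [dif_pos hp]⟩
  refine ⟨ζ, fun p₀ hp₀ => ContinuousAt.continuousWithinAt ?_, hζ⟩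
  obtain ⟨C, hC⟩ := h.norm_dilation_le hD hs hp₀
  have near := hD.mem_nhds hp₀
  refine continuousAt_of_dominated_coeff (summable_half_pow_natAbs.mul_left C) (fun k => ?_) ?_
  · have coeff_cont : ContinuousAt (fun p => s ^ k • ξ p k) p₀ :=
      ((lp.evalCLM ℝ (fun _ : ℤ => M2) 1 k).continuous.continuousAt.comp
        (hξ.continuousAt near)).const_smul (s ^ k)
    exact coeff_cont.congr (by filter_upwards [near] with p hp using (hζ p hp k).symm)
  · filter_upwards [hC, near] with p bound hp k
    rw [hζ p hp]
    exact bound k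

end AnalyticLoops

/-! ### Harmonic maps into the pseudosphere -/

section Geometry

theorem trace_of_mem_kPart {X : M2} (h : X ∈ kPart) : X.trace = 0 := by
  obtain ⟨a, rfl⟩ := Submodule.mem_span_singleton.1 h
  simp [matK, Matrix.trace_fin_two]

theorem trace_of_mem_mPart {X : M2} (h : X ∈ mPart) : X.trace = 0 := by
  obtain ⟨a, b, rfl⟩ := Submodule.mem_span_pair.1 h
  simp [matI, matJ, Matrix.trace_fin_two]

theorem mul_matK_of_mem_kPart {X : M2} (h : X ∈ kPart) : X * matK = matK * X := by
  obtain ⟨a, rfl⟩ := Submodule.mem_span_singleton.1 h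
  rw [smul_mul_assoc, mul_smul_comm]

theorem mem_kPart_of_sigma {X : M2} (trace : X.trace = 0) (h : sigma X = X) : X ∈ kPart := by
  refine Submodule.mem_span_singleton.2 ⟨X 1 1, ?_⟩
  rw [Matrix.trace_fin_two] at trace
  rw [sigma_entries] at h
  have upper : -X 0 1 = X 0 1 := congrFun₂ h 0 1
  have lower : -X 1 0 = X 1 0 := congrFun₂ h 1 0
  ext i j
  fin_cases i <;> fin_cases j <;> simp [matK] <;> linarith

theorem mem_mPart_of_sigma {X : M2} (h : sigma X = -X) : X ∈ mPart := by
  refine Submodule.mem_span_pair.2 ⟨(X 1 0 - X 0 1) / 2, (X 1 0 + X 0 1) / 2, ?_⟩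
  rw [sigma_entries] at h
  have first : X 0 0 = -X 0 0 := congrFun₂ h 0 0
  have second : X 1 1 = -X 1 1 := congrFun₂ h 1 1
  ext i j
  fin_cases i <;> fin_cases j <;> simp [matI, matJ] <;> linarith

theorem exists_lie_lie_matK_eq_smul {X Y : M2} (hX : X ∈ mPart) (hY : Y ∈ mPart) :
    ∃ c : ℝ, ⁅X, ⁅Y, matK⁆⁆ = c • matK := by
  obtain ⟨a, b, rfl⟩ := Submodule.mem_span_pair.1 hX
  obtain ⟨a', b', rfl⟩ := Submodule.mem_span_pair.1 hY
  refine ⟨4 * (b * b' - a * a'), ?_⟩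
  simp only [Ring.lie_def]
  ext i j
  fin_cases i <;> fin_cases j <;> simp [matI, matJ, matK] <;> ring

theorem Ad_eq_of_det {g : M2} (det : g.det = 1) (X : M2) : Ad g X = g * X * g.adjugate := by
  rw [Ad, Matrix.inv_def, det, Ring.inverse_one, one_smul]

theorem Ad_matK_mem_S21 {g : M2} (det : g.det = 1) : Ad g matK ∈ S21 := by
  have mul_adj : g * g.adjugate = 1 := by rw [Matrix.mul_adjugate, det, one_smul]
  have adj_mul : g.adjugate * g = 1 := by rw [Matrix.adjugate_mul, det, one_smul]
  rw [Ad_eq_of_det det]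
  refine ⟨?_, ?_⟩
  · rw [Matrix.trace_mul_comm, ← mul_assoc, adj_mul, one_mul, Matrix.trace_fin_two]
    simp [matK]
  · have square : g * matK * g.adjugate * (g * matK * g.adjugate) = 1 := by
      calc g * matK * g.adjugate * (g * matK * g.adjugate)
        _ = g * (matK * (g.adjugate * g) * matK) * g.adjugate := by noncomm_ring
        _ = 1 := by rw [adj_mul, mul_one, matK_mul_matK, mul_one, mul_adj]
    rw [scal, square, Matrix.trace_one]
    norm_num

theorem tangential_smul_self {N : M2} (h : scal N N = 1) (c : ℝ) : tangential N (c • N) = 0 := by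
  have scal_smul : scal (c • N) N = c * scal N N := by
    rw [scal, scal, smul_mul_assoc, Matrix.trace_smul, smul_eq_mul, mul_left_comm]
  rw [tangential, scal_smul, h, mul_one, sub_self]

theorem planeMetric_inv : planeMetric⁻¹ = !![0, 2; 2, 0] := by
  refine Matrix.inv_eq_right_inv ?_
  ext i j
  fin_cases i <;> fin_cases j <;> simp [planeMetric]

theorem hessian_eq (ψ : ℝ × ℝ → M2) (p v w : ℝ × ℝ) :
    hessian ψ p v w = tangential (ψ p) (fderiv ℝ (fun q => fderiv ℝ ψ q w) p v) := rfl

theorem tension_eq (ψ : ℝ × ℝ → M2) (p : ℝ × ℝ) :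
    tension ψ p = (2 : ℝ) • hessian ψ p (1, 0) (0, 1) + (2 : ℝ) • hessian ψ p (0, 1) (1, 0) := by
  rw [tension, planeMetric_inv]
  simp [Fin.sum_univ_two, coordVec]

theorem fderiv_fderiv_comm {E F : Type*} [NormedAddCommGroup E] [NormedSpace ℝ E]
    [NormedAddCommGroup F] [NormedSpace ℝ F] {ψ : E → F} {p : E} (h : ContDiffAt ℝ 2 ψ p)
    (v w : E) :
    fderiv ℝ (fun q => fderiv ℝ ψ q w) p v = fderiv ℝ (fun q => fderiv ℝ ψ q v) p w := by
  have symm : IsSymmSndFDerivAt ℝ ψ p :=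
    h.isSymmSndFDerivAt (minSmoothness_of_isRCLikeNormedField).le
  have diff : DifferentiableAt ℝ (fderiv ℝ ψ) p :=
    (h.fderiv_right (m := 1) le_rfl).differentiableAt one_ne_zero
  have second (v w : E) :
      fderiv ℝ (fun q => fderiv ℝ ψ q w) p v = fderiv ℝ (fderiv ℝ ψ) p v w := by
    simp [fderiv_clm_apply diff (differentiableAt_const w)]
  rw [second, second, symm v w]

variable {U : Set (ℝ × ℝ)} {Θ A B E : ℝ × ℝ → M2}

theorem isHarmonicMap_of_mixed_derivative (hU : IsOpen U) {ψ : ℝ × ℝ → M2}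
    (smooth : ContDiffOn ℝ ∞ ψ U) (mem : ∀ p ∈ U, ψ p ∈ S21)
    (mixed : ∀ p ∈ U, ∃ c : ℝ, fderiv ℝ (fun q => fderiv ℝ ψ q (1, 0)) p (0, 1) = c • ψ p) :
    IsHarmonicMap U ψ := by
  refine ⟨smooth, mem, fun p hp => ?_⟩
  obtain ⟨c, hc⟩ := mixed p hp
  have smooth_at : ContDiffAt ℝ 2 ψ p :=
    (smooth.contDiffAt (hU.mem_nhds hp)).of_le (WithTop.coe_le_coe.2 (le_top : (2 : ℕ∞) ≤ ⊤))
  have yx : hessian ψ p (0, 1) (1, 0) = 0 := by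
    rw [hessian_eq, hc, tangential_smul_self (mem p hp).2]
  have xy : hessian ψ p (1, 0) (0, 1) = 0 := by
    rw [hessian_eq, fderiv_fderiv_comm smooth_at, hc, tangential_smul_self (mem p hp).2]
  rw [tension_eq, xy, yx, smul_zero, add_zero]

theorem fderiv_conj {V : Type*} [NormedAddCommGroup V] [NormedSpace ℝ V] {Θ X : V → M2} {p v : V}
    {a : M2} (hΘ : DifferentiableAt ℝ Θ p) (hX : DifferentiableAt ℝ X p)
    (deriv : fderiv ℝ Θ p v = Θ p * a) (trace : a.trace = 0) :
    fderiv ℝ (fun q => Θ q * X q * (Θ q).adjugate) p v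
      = Θ p * (⁅a, X p⁆ + fderiv ℝ X p v) * (Θ p).adjugate := by
  have adj_deriv := (adjugateLin ℝ).toContinuousLinearMap.hasFDerivAt.comp p hΘ.hasFDerivAt
  have product : fderiv ℝ (fun q => Θ q * X q * (Θ q).adjugate) p v
      = Θ p * X p * (fderiv ℝ Θ p v).adjugate
        + (Θ p * fderiv ℝ X p v + fderiv ℝ Θ p v * X p) * (Θ p).adjugate :=
    congrArg (· v) ((hΘ.hasFDerivAt.mul' hX.hasFDerivAt).mul' adj_deriv).fderiv
  rw [product, deriv, Matrix.adjugate_mul_distrib, (trace_eq_zero_iff_adjugate a).1 trace,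
    Ring.lie_def]
  noncomm_ring

theorem fderiv_lie_matK {V : Type*} [NormedAddCommGroup V] [NormedSpace ℝ V] {X : V → M2} {p : V}
    (hX : DifferentiableAt ℝ X p) (v : V) :
    fderiv ℝ (fun q => ⁅X q, matK⁆) p v = ⁅fderiv ℝ X p v, matK⁆ :=
  congrArg (· v) ((hX.hasFDerivAt.mul_const' matK).sub (hX.hasFDerivAt.const_mul matK)).fderiv

/-- In the gauge where `Θ⁻¹ ∂Θ/∂y` is `𝔪`-valued, `ψ = Ad(Θ) matK` has
`∂²ψ/∂y∂x = Ad(Θ) ⁅E, ⁅B, matK⁆⁆`, which is normal since `⁅𝔪, 𝔪⁆ ⊆ 𝔨`. -/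
theorem isHarmonicMap_Ad_matK (hU : IsOpen U) (hΘ : ContDiffOn ℝ ∞ Θ U)
    (det : ∀ p ∈ U, (Θ p).det = 1)
    (deriv_x : ∀ p ∈ U, fderiv ℝ Θ p (1, 0) = Θ p * (A p + B p))
    (deriv_y : ∀ p ∈ U, fderiv ℝ Θ p (0, 1) = Θ p * E p) (hA : ∀ p ∈ U, A p ∈ kPart)
    (hB : ∀ p ∈ U, B p ∈ mPart) (hE : ∀ p ∈ U, E p ∈ mPart) (B_diff : DifferentiableOn ℝ B U)
    (B_deriv : ∀ p ∈ U, fderiv ℝ B p (0, 1) = 0) :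
    IsHarmonicMap U (fun p => Ad (Θ p) matK) := by
  have eq : ∀ p ∈ U, Ad (Θ p) matK = Θ p * matK * (Θ p).adjugate :=
    fun p hp => Ad_eq_of_det (det p hp) matK
  have Θ_diff {p} (hp : p ∈ U) : DifferentiableAt ℝ Θ p :=
    (hΘ.contDiffAt (hU.mem_nhds hp)).differentiableAt (by simp)
  have first {p} (hp : p ∈ U) : fderiv ℝ (fun q => Ad (Θ q) matK) p (1, 0)
      = Θ p * ⁅B p, matK⁆ * (Θ p).adjugate := by
    have trace : (A p + B p).trace = 0 := by
      rw [Matrix.trace_add, trace_of_mem_kPart (hA p hp), trace_of_mem_mPart (hB p hp), add_zero]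
    have lie : ⁅A p + B p, matK⁆ = ⁅B p, matK⁆ := by
      rw [Ring.lie_def, Ring.lie_def, add_mul, mul_add, mul_matK_of_mem_kPart (hA p hp)]
      abel
    rw [(Filter.eventuallyEq_of_mem (hU.mem_nhds hp) eq).fderiv_eq,
      fderiv_conj (Θ_diff hp) (differentiableAt_const _) (deriv_x p hp) trace, lie,
      fderiv_fun_const, Pi.zero_apply, zero_apply, add_zero]
  refine isHarmonicMap_of_mixed_derivative hU (((hΘ.mul contDiffOn_const).mul
    ((adjugateLin ℝ).toContinuousLinearMap.contDiff.comp_contDiffOn hΘ)).congr eq)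
    (fun p hp => Ad_matK_mem_S21 (det p hp)) fun p hp => ?_
  have Bp_diff := B_diff.differentiableAt (hU.mem_nhds hp)
  have lie_diff : DifferentiableAt ℝ (fun q => ⁅B q, matK⁆) p :=
    (Bp_diff.mul_const matK).sub (Bp_diff.const_mul matK)
  obtain ⟨c, hc⟩ := exists_lie_lie_matK_eq_smul (hE p hp) (hB p hp)
  refine ⟨c, ?_⟩
  rw [(Filter.eventuallyEq_of_mem (hU.mem_nhds hp) fun q hq => first hq).fderiv_eq,
    fderiv_conj (Θ_diff hp) lie_diff (deriv_y p hp) (trace_of_mem_mPart (hE p hp)),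
    fderiv_lie_matK Bp_diff, B_deriv p hp, Ring.lie_def 0, zero_mul, mul_zero, sub_zero,
    add_zero, hc, eq p hp, mul_smul_comm, smul_mul_assoc]

end Geometry

/-! ### Frames in the twisted loop group -/

section ChiralFrame

variable {E : Type*} [NormedAddCommGroup E] [NormedSpace ℝ E] {D : Set E} {π : E →L[ℝ] ℝ}
  {ξ Ψ : E → Loop} {p₀ : E}

theorem isUnit_of_mem_loopGroup {γ : Loop} (h : γ ∈ loopGroup) : IsUnit γ :=
  ⟨⟨γ, adj γ, mul_adj_self h, adj_mul_self h⟩, rfl⟩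

theorem IsFrame.mem_loopGroup (hD : IsOpen D) (conn : IsPreconnected D)
    (mem : ∀ p ∈ D, ξ p ∈ loopAlg) (hΨ : IsFrame D π ξ Ψ) (unit : ∀ p ∈ D, IsUnit (Ψ p))
    (hp₀ : p₀ ∈ D) (init : Ψ p₀ = 1) : ∀ p ∈ D, Ψ p ∈ loopGroup := by
  have twist_frame : IsFrame D π ξ fun p => twist (Ψ p) := fun p hp => by
    refine (twist.hasFDerivAt.comp p (hΨ p hp)).congr_fderiv ?_
    ext1 v
    change twist (π v • (Ψ p * ξ p)) = π v • (twist (Ψ p) * ξ p)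
    rw [map_smul, twist_mul, ((mem_loopAlg_iff _).1 (mem p hp)).2]
  have twist_eq : Set.EqOn (fun p => twist (Ψ p)) Ψ D :=
    twist_frame.eqOn hD conn hΨ unit hp₀ (by rw [init, twist_one])
  have deriv : ∀ p ∈ D, HasFDerivAt (fun p => Ψ p * adj (Ψ p)) (0 : E →L[ℝ] Loop) p := by
    intro p hp
    refine ((hΨ p hp).mul' (adj.hasFDerivAt.comp p (hΨ p hp))).congr_fderiv ?_
    ext1 v
    change Ψ p * adj (π v • (Ψ p * ξ p)) + (π v • (Ψ p * ξ p)) * adj (Ψ p) = 0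
    have skew : adj (ξ p) + ξ p = 0 := eq_neg_iff_add_eq_zero.1 ((mem_loopAlg_iff _).1 (mem p hp)).1
    rw [map_smul, adj_mul, mul_smul_comm, smul_mul_assoc, ← smul_add, mul_assoc, ← mul_add,
      ← add_mul, skew, zero_mul, mul_zero, smul_zero]
  have const : ∀ p ∈ D, Ψ p * adj (Ψ p) = Ψ p₀ * adj (Ψ p₀) := fun p hp =>
    hD.is_const_of_fderiv_eq_zero conn
      (fun p hp => (deriv p hp).differentiableAt.differentiableWithinAt)
      (fun p hp => (deriv p hp).fderiv) hp hp₀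
  exact fun p hp => (mem_loopGroup_iff _).2
    ⟨by rw [const p hp, init, adj_one, mul_one], twist_eq hp⟩

/-- `ξ dπ` is a smooth `1`-form with values in the twisted loop algebra which depends on the
coordinate `π` only. Taking for `π` the two null coordinates gives the common part of Lorentz
holomorphic and antiholomorphic potentials. -/
structure IsChiralPotential (D : Set E) (π : E →L[ℝ] ℝ) (ξ : E → Loop) : Prop where
  smooth : ContDiffOn ℝ ∞ ξ D
  mem : ∀ p ∈ D, ξ p ∈ loopAlg
  factors : FactorsLocally D π ξ

/-- `Ψ` is the solution of `dΨ = Ψ ξ dπ` with `Ψ p₀ = 1` and values in the twisted loop group. -/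
structure IsChiralFrame (D : Set E) (π : E →L[ℝ] ℝ) (p₀ : E) (ξ Ψ : E → Loop) : Prop where
  potential : IsChiralPotential D π ξ
  isFrame : IsFrame D π ξ Ψ
  mem : ∀ p ∈ D, Ψ p ∈ loopGroup
  init : Ψ p₀ = 1

namespace IsChiralFrame

theorem smooth (hD : IsOpen D) (hΨ : IsChiralFrame D π p₀ ξ Ψ) : ContDiffOn ℝ ∞ Ψ D :=
  hΨ.isFrame.contDiffOn hD hΨ.potential.smooth

theorem eqOn (hD : IsOpen D) (conn : IsPreconnected D) (hΨ : IsChiralFrame D π p₀ ξ Ψ)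
    (hp₀ : p₀ ∈ D) {Φ : E → Loop} (hΦ : IsFrame D π ξ Φ) (init : Φ p₀ = 1) : Set.EqOn Φ Ψ D :=
  hΦ.eqOn hD conn hΨ.isFrame (fun p hp => isUnit_of_mem_loopGroup (hΨ.mem p hp)) hp₀
    (init.trans hΨ.init.symm)

variable [SimplyConnectedSpace D] {e : E}

theorem exists_contDiffOn_isDilation (hD : IsOpen D) (he : π e = 1)
    (hΨ : IsChiralFrame D π p₀ ξ Ψ) (hp₀ : p₀ ∈ D) {s K : ℝ} (hs : s ≠ 0) {P : Set ℤ}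
    (powers : ∀ p ∈ D, ξ p ∈ powersIn P) (hK : ∀ k ∈ P, |s ^ k| ≤ K) :
    ∃ Φ : E → Loop, ContDiffOn ℝ ∞ Φ D ∧ ∀ p ∈ D, IsDilation s (Ψ p) (Φ p) := by
  obtain ⟨L, hL⟩ := exists_clm_isDilation (A := M2) hK
  have smooth : ContDiffOn ℝ ∞ (fun p => L (ξ p)) D :=
    L.contDiff.comp_contDiffOn hΨ.potential.smooth
  obtain ⟨Φ, hΦ, dil⟩ := hΨ.isFrame.exists_isDilation hD he hs
    hΨ.potential.smooth.continuousOn smooth.continuousOn hΨ.potential.factors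
    (fun p hp => hL _ (powers p hp)) hp₀ hΨ.init
  exact ⟨Φ, hΦ.contDiffOn hD smooth, dil⟩

end IsChiralFrame

theorem IsChiralPotential.exists_isChiralFrame [SimplyConnectedSpace D] (hD : IsOpen D) {e : E}
    (he : π e = 1) (hξ : IsChiralPotential D π ξ) (hp₀ : p₀ ∈ D) :
    ∃ Ψ, IsChiralFrame D π p₀ ξ Ψ := by
  obtain ⟨Ψ, init, hΨ, unit⟩ := hξ.factors.exists_isFrame hD he hξ.smooth.continuousOn hp₀
  exact ⟨Ψ, hξ, hΨ, hΨ.mem_loopGroup hD (isPreconnected_iff_preconnectedSpace.2 inferInstance)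
    hξ.mem unit hp₀ init, init⟩

end ChiralFrame

section NullCoordinates

variable {D : Set (ℝ × ℝ)} {ξ Ψ : ℝ × ℝ → Loop}

theorem IsChiralFrame.mem_loopGroupAn [SimplyConnectedSpace D] (hD : IsOpen D)
    {π : ℝ × ℝ →L[ℝ] ℝ} {e p₀ : ℝ × ℝ} (he : π e = 1) (hΨ : IsChiralFrame D π p₀ ξ Ψ)
    (hp₀ : p₀ ∈ D) (analytic : AnalyticLoops D ξ) : ∀ p ∈ D, Ψ p ∈ loopGroupAn := by
  refine fun p hp => ⟨hΨ.mem p hp, extendsAnalytically_of_isDilation fun s hs => ?_⟩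
  have ξ_cont := hΨ.potential.smooth.continuousOn
  obtain ⟨ζ, ζ_cont, dil⟩ := analytic.exists_isDilation hD ξ_cont hs
  obtain ⟨Φ, -, hΦ⟩ := hΨ.isFrame.exists_isDilation hD he hs.ne' ξ_cont ζ_cont
    hΨ.potential.factors dil hp₀ hΨ.init
  exact ⟨Φ p, hΦ p hp⟩

theorem IsPotentialX.isChiralPotential (hD : IsOpen D) (h : IsPotentialX D ξ) :
    IsChiralPotential D (.fst ℝ ℝ ℝ) ξ := by
  refine ⟨h.smooth, h.mem,
    factorsLocally_of_fderiv hD (h.smooth.differentiableOn (by simp)) fun p hp v hv => ?_⟩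
  have v_eq : v = v.2 • ((0, 1) : ℝ × ℝ) :=
    Prod.ext (hv.trans (mul_zero _).symm) (mul_one _).symm
  rw [v_eq, map_smul, h.holomorphic p hp, smul_zero]

theorem IsPotentialY.isChiralPotential (hD : IsOpen D) (h : IsPotentialY D ξ) :
    IsChiralPotential D (.snd ℝ ℝ ℝ) ξ := by
  refine ⟨h.smooth, h.mem,
    factorsLocally_of_fderiv hD (h.smooth.differentiableOn (by simp)) fun p hp v hv => ?_⟩
  have v_eq : v = v.1 • ((1, 0) : ℝ × ℝ) :=
    Prod.ext (mul_one _).symm (hv.trans (mul_zero _).symm)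
  rw [v_eq, map_smul, h.antiholomorphic p hp, smul_zero]

theorem solvesFrame_iff (hD : IsOpen D) {a b : ℝ × ℝ → Loop} :
    SolvesFrame D Ψ a b ↔ ∀ p ∈ D, HasFDerivAt Ψ
      ((ContinuousLinearMap.fst ℝ ℝ ℝ).smulRight (Ψ p * a p) +
        (ContinuousLinearMap.snd ℝ ℝ ℝ).smulRight (Ψ p * b p)) p := by
  constructor
  · rintro ⟨diff, partials⟩ p hp
    refine (diff.differentiableAt (hD.mem_nhds hp)).hasFDerivAt.congr_fderiv ?_
    refine ContinuousLinearMap.ext fun v => ?_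
    have v_eq : v = v.1 • ((1, 0) : ℝ × ℝ) + v.2 • ((0, 1) : ℝ × ℝ) := by simp
    calc fderiv ℝ Ψ p v
      _ = v.1 • fderiv ℝ Ψ p (1, 0) + v.2 • fderiv ℝ Ψ p (0, 1) := by
        conv_lhs => rw [v_eq, map_add, map_smul, map_smul]
      _ = v.1 • (Ψ p * a p) + v.2 • (Ψ p * b p) := by
        rw [(partials p hp).1, (partials p hp).2, mul_eq, mul_eq]
  · refine fun h => ⟨fun p hp => (h p hp).differentiableAt.differentiableWithinAt, fun p hp => ?_⟩
    rw [(h p hp).fderiv, mul_eq, mul_eq]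
    simp

theorem solvesFrame_fst_iff (hD : IsOpen D) :
    SolvesFrame D Ψ ξ (fun _ => 0) ↔ IsFrame D (.fst ℝ ℝ ℝ) ξ Ψ := by
  simp only [solvesFrame_iff hD, IsFrame, mul_zero, ContinuousLinearMap.smulRight_zero, add_zero]

theorem solvesFrame_snd_iff (hD : IsOpen D) :
    SolvesFrame D Ψ (fun _ => 0) ξ ↔ IsFrame D (.snd ℝ ℝ ℝ) ξ Ψ := by
  simp only [solvesFrame_iff hD, IsFrame, mul_zero, ContinuousLinearMap.smulRight_zero, zero_add]

variable [SimplyConnectedSpace D]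

theorem IsChiralFrame.isTheSolution_fst (hD : IsOpen D)
    (hΨ : IsChiralFrame D (.fst ℝ ℝ ℝ) (0, 0) ξ Ψ) (h0 : (0, 0) ∈ D) :
    IsTheSolution D Ψ ξ (fun _ => 0) :=
  ⟨hΨ.smooth hD, hΨ.mem, (solvesFrame_fst_iff hD).2 hΨ.isFrame, hΨ.init, fun _ hΦ =>
    hΨ.eqOn hD (isPreconnected_iff_preconnectedSpace.2 inferInstance) h0
      ((solvesFrame_fst_iff hD).1 hΦ)⟩

theorem IsChiralFrame.isTheSolution_snd (hD : IsOpen D)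
    (hΨ : IsChiralFrame D (.snd ℝ ℝ ℝ) (0, 0) ξ Ψ) (h0 : (0, 0) ∈ D) :
    IsTheSolution D Ψ (fun _ => 0) ξ :=
  ⟨hΨ.smooth hD, hΨ.mem, (solvesFrame_snd_iff hD).2 hΨ.isFrame, hΨ.init, fun _ hΦ =>
    hΨ.eqOn hD (isPreconnected_iff_preconnectedSpace.2 inferInstance) h0
      ((solvesFrame_snd_iff hD).1 hΦ)⟩

end NullCoordinates

/-! ### The Maurer–Cartan form -/

section MaurerCartan

variable {E : Type*} [NormedAddCommGroup E] [NormedSpace ℝ E] {p : E}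

theorem map_fderiv_apply {F G : Type*} [NormedAddCommGroup F] [NormedSpace ℝ F]
    [NormedAddCommGroup G] [NormedSpace ℝ G] (L : F →L[ℝ] G) {f : E → F} {g : E → G}
    (hf : DifferentiableAt ℝ f p) (h : ∀ᶠ q in 𝓝 p, L (f q) = g q) (v : E) :
    L (fderiv ℝ f p v) = fderiv ℝ g p v := by
  rw [((L.hasFDerivAt.comp p hf.hasFDerivAt).congr_of_eventuallyEq
    (h.mono fun _ => Eq.symm)).fderiv, ContinuousLinearMap.comp_apply]

/-- The coefficient of `λ^k`. -/
def coeff (k : ℤ) : Loop →L[ℝ] M2 := lp.evalCLM ℝ (fun _ : ℤ => M2) 1 k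

theorem fderiv_mem_powersIn {f : E → Loop} (hf : DifferentiableAt ℝ f p) {s : Set ℤ} (c : ℤ → M2)
    (h : ∀ᶠ q in 𝓝 p, ∀ k ∉ s, f q k = c k) (v : E) : fderiv ℝ f p v ∈ powersIn s := by
  refine mem_powersIn.2 fun k hk => ?_
  have const := map_fderiv_apply (coeff k) hf (h.mono fun q hq => hq k hk) v
  rwa [fderiv_fun_const, Pi.zero_apply, zero_apply] at const

theorem IsDilation.fderiv {f g : E → Loop} {s : ℝ} (hf : DifferentiableAt ℝ f p)
    (hg : DifferentiableAt ℝ g p) (h : ∀ᶠ q in 𝓝 p, IsDilation s (f q) (g q)) (v : E) :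
    IsDilation s (fderiv ℝ f p v) (fderiv ℝ g p v) := fun k =>
  (map_fderiv_apply (coeff k) hg (h.mono fun _ hq => hq k) v).trans
    (map_fderiv_apply (s ^ k • coeff k) hf (.of_forall fun _ => rfl) v).symm

/-- The Maurer–Cartan form `Ψ⁻¹ dΨ` of a map `Ψ` into the loop group, at the tangent vector `v`. The
inverse is the coefficientwise adjugate. -/
def maurerCartan (Ψ : E → Loop) (p v : E) : Loop := adj (Ψ p) * fderiv ℝ Ψ p v

theorem mul_maurerCartan {Ψ : E → Loop} (mem : Ψ p ∈ loopGroup) (v : E) :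
    Ψ p * maurerCartan Ψ p v = fderiv ℝ Ψ p v :=
  mul_adj_cancel_left mem _

theorem maurerCartan_mem_loopAlg {Ψ : E → Loop} (mem : ∀ᶠ q in 𝓝 p, Ψ q ∈ loopGroup)
    (hΨ : DifferentiableAt ℝ Ψ p) (v : E) : maurerCartan Ψ p v ∈ loopAlg := by
  refine (mem_loopAlg_iff _).2 ⟨?_, ?_⟩
  · have product := (adj.hasFDerivAt.comp p hΨ.hasFDerivAt).mul' hΨ.hasFDerivAt
    have const : HasFDerivAt (fun q => adj (Ψ q) * Ψ q) (0 : E →L[ℝ] Loop) p :=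
      (hasFDerivAt_const (1 : Loop) p).congr_of_eventuallyEq (mem.mono fun q => adj_mul_self)
    have sum : adj (Ψ p) * fderiv ℝ Ψ p v + adj (fderiv ℝ Ψ p v) * Ψ p = 0 :=
      congrArg (· v) (product.unique const)
    rw [maurerCartan, adj_mul, adj_adj, eq_neg_iff_add_eq_zero, add_comm, sum]
  · have fixed : ∀ᶠ q in 𝓝 p, twist (Ψ q) = Ψ q :=
      mem.mono fun q hq => ((mem_loopGroup_iff _).1 hq).2
    rw [maurerCartan, twist_mul, twist_adj, fixed.self_of_nhds, map_fderiv_apply twist hΨ fixed]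

theorem maurerCartan_of_eq_mul {Φ Ψ M : E → Loop} (h : ∀ᶠ q in 𝓝 p, Φ q = Ψ q * M q)
    (hΨ : DifferentiableAt ℝ Ψ p) (hM : DifferentiableAt ℝ M p) (Ψ_mem : Ψ p ∈ loopGroup)
    (M_mem : M p ∈ loopGroup) (v : E) : maurerCartan Ψ p v =
      M p * maurerCartan Φ p v * adj (M p) - fderiv ℝ M p v * adj (M p) := by
  have leibniz : fderiv ℝ Φ p v = Ψ p * fderiv ℝ M p v + fderiv ℝ Ψ p v * M p :=
    congrArg (· v) ((hΨ.hasFDerivAt.mul' hM.hasFDerivAt).congr_of_eventuallyEq h).fderiv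
  have form : maurerCartan Φ p v =
      adj (M p) * fderiv ℝ M p v + adj (M p) * maurerCartan Ψ p v * M p := by
    rw [maurerCartan, leibniz, h.self_of_nhds, adj_mul, mul_add, mul_assoc, mul_assoc,
      adj_mul_cancel_left Ψ_mem, maurerCartan, mul_assoc, mul_assoc]
  rw [form, mul_add, mul_adj_cancel_left M_mem, mul_assoc (adj (M p)), mul_adj_cancel_left M_mem,
    add_mul, mul_assoc (maurerCartan Ψ p v), mul_adj_self M_mem, mul_one, add_sub_cancel_left]

theorem IsChiralFrame.maurerCartan_eq {D : Set E} {π : E →L[ℝ] ℝ} {p₀ : E} {ξ Φ : E → Loop}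
    (hΦ : IsChiralFrame D π p₀ ξ Φ) (hp : p ∈ D) (v : E) : maurerCartan Φ p v = π v • ξ p := by
  have deriv : fderiv ℝ Φ p v = π v • (Φ p * ξ p) := congrArg (· v) (hΦ.isFrame p hp).fderiv
  rw [maurerCartan, deriv, mul_smul_comm, adj_mul_cancel_left (hΦ.mem p hp)]

theorem fderiv_mul_adj_mem_powersIn_Iic {M : E → Loop} (hM : DifferentiableAt ℝ M p)
    (mem : ∀ᶠ q in 𝓝 p, M q ∈ loopGroupMinusStar) (v : E) :
    fderiv ℝ M p v * adj (M p) ∈ powersIn (Set.Iic (-1)) := by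
  have coeff_eq {γ : Loop} (hγ : γ ∈ loopGroupMinusStar) {k : ℤ} (hk : k ∉ Set.Iic (-1)) :
      γ k = (1 : Loop) k := by
    rcases (show 0 ≤ k by simpa [Int.lt_iff_add_one_le] using hk).eq_or_lt with rfl | pos
    · rw [hγ.2.2, one_coeff_zero]
    · rw [hγ.2.1 k pos, one_eq_single, lp.single_apply_ne _ _ _ pos.ne']
  have deriv : fderiv ℝ M p v ∈ powersIn (Set.Iic (-1)) :=
    fderiv_mem_powersIn hM (1 : Loop) (mem.mono fun q hq k => coeff_eq hq) v
  simpa only [add_zero] using mul_mem_powersIn_Iic deriv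
    (adj_mem_powersIn (mem_loopGroupMinusStar_iff.1 mem.self_of_nhds).2.1)

theorem fderiv_mul_adj_mem_powersIn_Ici {N : E → Loop} (hN : DifferentiableAt ℝ N p)
    (mem : ∀ᶠ q in 𝓝 p, N q ∈ loopGroupPlus) (v : E) :
    fderiv ℝ N p v * adj (N p) ∈ powersIn (Set.Ici 0) := by
  have powers {γ : Loop} (hγ : γ ∈ loopGroupPlus) : γ ∈ powersIn (Set.Ici 0) :=
    (mem_loopGroupPlus_iff.1 hγ).2
  have deriv : fderiv ℝ N p v ∈ powersIn (Set.Ici 0) :=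
    fderiv_mem_powersIn hN 0 (mem.mono fun q hq => mem_powersIn.1 (powers hq)) v
  simpa only [add_zero] using mul_mem_powersIn_Ici deriv
    (adj_mem_powersIn (powers mem.self_of_nhds))

theorem contDiffOn_maurerCartan {U : Set E} (hU : IsOpen U) {Ψ : E → Loop}
    (hΨ : ContDiffOn ℝ ∞ Ψ U) (v : E) : ContDiffOn ℝ ∞ (fun p => maurerCartan Ψ p v) U :=
  (adj.contDiff.comp_contDiffOn hΨ).mul
    ((hΨ.fderiv_of_isOpen hU (by simp)).clm_apply contDiffOn_const)

end MaurerCartan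

section Conjugation

variable {γ ξ : Loop} {n : ℤ}

theorem conj_mem_powersIn_Iic (hγ : γ ∈ powersIn (Set.Iic 0)) (hξ : ξ ∈ powersIn (Set.Iic n)) :
    γ * ξ * adj γ ∈ powersIn (Set.Iic n) := by
  simpa using mul_mem_powersIn_Iic (mul_mem_powersIn_Iic hγ hξ) (adj_mem_powersIn hγ)

theorem conj_mem_powersIn_Ici (hγ : γ ∈ powersIn (Set.Ici 0)) (hξ : ξ ∈ powersIn (Set.Ici n)) :
    γ * ξ * adj γ ∈ powersIn (Set.Ici n) := by
  simpa using mul_mem_powersIn_Ici (mul_mem_powersIn_Ici hγ hξ) (adj_mem_powersIn hγ)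

theorem conj_coeff_top (hγ : γ ∈ powersIn (Set.Iic 0)) (coeff_zero : γ 0 = 1)
    (hξ : ξ ∈ powersIn (Set.Iic n)) : (γ * ξ * adj γ) n = ξ n := by
  have left := mul_coeff_top hγ hξ
  have right := mul_coeff_top (mul_mem_powersIn_Iic hγ hξ) (adj_mem_powersIn hγ)
  simpa [left, adj_coeff, coeff_zero] using right

end Conjugation

/-! ### Values of loops at real parameters -/

namespace Loop

/-- The value of a loop at `λ = 1`. -/
def total : Loop →L[ℝ] M2 := lp.tsumCLM ℝ ℤ M2

theorem total_mul (ξ η : Loop) : total (ξ * η) = total ξ * total η :=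
  tsum_graded_mul (φ := fun _ => .id ℝ M2) (fun _ => ContinuousLinearMap.norm_id_le)
    (fun _ _ _ _ => rfl) ξ η

theorem total_single (k : ℤ) (X : M2) : total (lp.single 1 k X) = X :=
  (tsum_eq_single k fun _ hn => lp.single_apply_ne _ _ _ hn).trans (lp.single_apply_self _ _ _)

theorem total_adj (ξ : Loop) : total (adj ξ) = (total ξ).adjugate :=
  ((adjugateLin ℝ).toContinuousLinearMap.map_tsum (summable_norm_coeff ξ).of_norm).symm

end Loop

section EvalReal

variable {t : ℝ} {ξ η : Loop}

theorem IsDilation.adj (h : IsDilation t ξ η) : IsDilation t (adj ξ) (adj η) := fun k => by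
  rw [adj_coeff, h k, adj_coeff, Matrix.adjugate_smul, Fintype.card_fin, pow_one]

theorem IsDilation.evalReal_eq (h : IsDilation t ξ η) : ξ.evalReal t = total η :=
  tsum_congr fun k => (h k).symm

theorem IsDilation.mul_adj_self (ht : t ≠ 0) (h : IsDilation t ξ η) (hξ : ξ ∈ loopGroup) :
    η * Loop.adj η = 1 :=
  (Timelike.mul_adj_self hξ ▸ h.mul ht h.adj).unique (isDilation_one t)

theorem IsDilation.det_evalReal (ht : t ≠ 0) (h : IsDilation t ξ η) (hξ : ξ ∈ loopGroup) :
    (ξ.evalReal t).det = 1 := by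
  have scalar : (total η).det • (1 : M2) = 1 := by
    rw [← Matrix.mul_adjugate, ← total_adj, ← total_mul, h.mul_adj_self ht hξ, one_eq_single,
      total_single]
  simpa [h.evalReal_eq] using congrFun₂ scalar 0 0

theorem evalReal_single (t : ℝ) (k : ℤ) (X : M2) :
    evalReal (lp.single 1 k X) t = t ^ k • X :=
  (isDilation_single t k X).evalReal_eq.trans (total_single k _)

theorem evalReal_single_add_single (t : ℝ) (k l : ℤ) (X Y : M2) :
    evalReal (lp.single 1 k X + lp.single 1 l Y) t = t ^ k • X + t ^ l • Y := by
  rw [((isDilation_single t k X).add (isDilation_single t l Y)).evalReal_eq, map_add,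
    total_single, total_single]

theorem fderiv_evalReal {E : Type*} [NormedAddCommGroup E] [NormedSpace ℝ E] {p : E}
    {Ψ Φ : E → Loop} (ht : t ≠ 0) (hΨ : DifferentiableAt ℝ Ψ p) (hΦ : DifferentiableAt ℝ Φ p)
    (dil : ∀ᶠ q in 𝓝 p, IsDilation t (Ψ q) (Φ q)) (mem : Ψ p ∈ loopGroup) (v : E) :
    fderiv ℝ (fun q => (Ψ q).evalReal t) p v =
      (Ψ p).evalReal t * (maurerCartan Ψ p v).evalReal t := by
  have form : IsDilation t (maurerCartan Ψ p v) (maurerCartan Φ p v) :=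
    dil.self_of_nhds.adj.mul ht (.fderiv hΨ hΦ dil v)
  rw [← map_fderiv_apply total hΦ (dil.mono fun q hq => hq.evalReal_eq.symm),
    dil.self_of_nhds.evalReal_eq, form.evalReal_eq, ← total_mul, maurerCartan, ← mul_assoc,
    dil.self_of_nhds.mul_adj_self ht mem, one_mul]

end EvalReal

/-! ### Split frames -/

theorem IsIwasawa.eq_mul_adj_fst {g h Ψ M N : Loop} (H : IsIwasawa g h Ψ M N) :
    Ψ = g * adj M := by
  rw [H.fst_eq, mul_eq, mul_assoc, mul_adj_self H.minus.1, mul_one]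

theorem IsIwasawa.eq_mul_adj_snd {g h Ψ M N : Loop} (H : IsIwasawa g h Ψ M N) :
    Ψ = h * adj N := by
  rw [H.snd_eq, mul_eq, mul_assoc, mul_adj_self H.plus.1, mul_one]

theorem mem_loopGroupAn_of_eq_mul {g Ψ M : Loop} (hΨ : Ψ ∈ loopGroupAn) (hM : M ∈ loopGroup)
    (h : g = Ψ * M) (hg : g ∈ loopGroupAn) : M ∈ loopGroupAn := by
  refine ⟨hM, ?_⟩
  rw [← adj_mul_cancel_left hΨ.1 M, ← h]
  exact hΨ.2.adj.mul hg.2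

/-- The frames `Ψ₁` and `Ψ₂` of the potentials `ξ₁ dx` and `ξ₂ dy` split on `U` as
`(Ψ₁, Ψ₂) = (Ψ, Ψ)(M, N)`. The paper writes `ξ', ξ'', Ψ', Ψ''` for `ξ₁, ξ₂, Ψ₁, Ψ₂` and
`L₋⁻¹, L₊⁻¹` for `M, N`. -/
structure IsSplitPair (D U : Set (ℝ × ℝ)) (ξ₁ ξ₂ Ψ₁ Ψ₂ Ψ M N : ℝ × ℝ → Loop) : Prop where
  isOpen : IsOpen U
  subset : U ⊆ D
  potentialX : IsPotentialX D ξ₁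
  potentialY : IsPotentialY D ξ₂
  frameX : IsChiralFrame D (.fst ℝ ℝ ℝ) (0, 0) ξ₁ Ψ₁
  frameY : IsChiralFrame D (.snd ℝ ℝ ℝ) (0, 0) ξ₂ Ψ₂
  split : ∀ p ∈ U, IsIwasawa (Ψ₁ p) (Ψ₂ p) (Ψ p) (M p) (N p)

namespace IsSplitPair

variable {D U : Set (ℝ × ℝ)} {ξ₁ ξ₂ Ψ₁ Ψ₂ Ψ M N : ℝ × ℝ → Loop}

section Form

variable (hD : IsOpen D) (S : IsSplitPair D U ξ₁ ξ₂ Ψ₁ Ψ₂ Ψ M N)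

include hD S

theorem contDiffOn_factors : ContDiffOn ℝ ∞ M U ∧ ContDiffOn ℝ ∞ N U := by
  have smooth {p} (hp : p ∈ U) : ContDiffAt ℝ ∞ M p ∧ ContDiffAt ℝ ∞ N p := by
    have hDp := hD.mem_nhds (S.subset hp)
    refine IsIwasawa.contDiffAt ((S.frameX.smooth hD).contDiffAt hDp)
      ((S.frameY.smooth hD).contDiffAt hDp) ?_
      (Filter.eventually_of_mem (S.isOpen.mem_nhds hp) S.split)
    exact Filter.eventually_of_mem hDp fun q hq => ⟨S.frameX.mem q hq, S.frameY.mem q hq⟩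
  exact ⟨fun p hp => (smooth hp).1.contDiffWithinAt, fun p hp => (smooth hp).2.contDiffWithinAt⟩

theorem contDiffOn : ContDiffOn ℝ ∞ Ψ U :=
  (((S.frameX.smooth hD).mono S.subset).mul
    (adj.contDiff.comp_contDiffOn (S.contDiffOn_factors hD).1)).congr
    fun p hp => (S.split p hp).eq_mul_adj_fst

variable {p : ℝ × ℝ} (hp : p ∈ U)

include hp

theorem differentiableAt : DifferentiableAt ℝ Ψ p :=
  ((S.contDiffOn hD).contDiffAt (S.isOpen.mem_nhds hp)).differentiableAt (by simp)

omit hD in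
theorem eventually_split : ∀ᶠ q in 𝓝 p, IsIwasawa (Ψ₁ q) (Ψ₂ q) (Ψ q) (M q) (N q) :=
  Filter.eventually_of_mem (S.isOpen.mem_nhds hp) S.split

theorem maurerCartan_sub_mem_powersIn_Iic (v : ℝ × ℝ) :
    maurerCartan Ψ p v - v.1 • (M p * ξ₁ p * adj (M p)) ∈ powersIn (Set.Iic (-1)) := by
  have M_diff : DifferentiableAt ℝ M p :=
    ((S.contDiffOn_factors hD).1.contDiffAt (S.isOpen.mem_nhds hp)).differentiableAt (by simp)
  have split := S.eventually_split hp
  rw [maurerCartan_of_eq_mul (split.mono fun _ H => H.fst_eq) (S.differentiableAt hD hp) M_diff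
    (S.split p hp).mem (S.split p hp).minus.1, S.frameX.maurerCartan_eq (S.subset hp),
    mul_smul_comm, smul_mul_assoc, ContinuousLinearMap.coe_fst', sub_sub_cancel_left]
  exact neg_mem (fderiv_mul_adj_mem_powersIn_Iic M_diff (split.mono fun _ H => H.minus) v)

theorem maurerCartan_sub_mem_powersIn_Ici (v : ℝ × ℝ) :
    maurerCartan Ψ p v - v.2 • (N p * ξ₂ p * adj (N p)) ∈ powersIn (Set.Ici 0) := by
  have N_diff : DifferentiableAt ℝ N p :=
    ((S.contDiffOn_factors hD).2.contDiffAt (S.isOpen.mem_nhds hp)).differentiableAt (by simp)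
  have split := S.eventually_split hp
  rw [maurerCartan_of_eq_mul (split.mono fun _ H => H.snd_eq) (S.differentiableAt hD hp) N_diff
    (S.split p hp).mem (S.split p hp).plus.1, S.frameY.maurerCartan_eq (S.subset hp),
    mul_smul_comm, smul_mul_assoc, ContinuousLinearMap.coe_snd', sub_sub_cancel_left]
  exact neg_mem (fderiv_mul_adj_mem_powersIn_Ici N_diff (split.mono fun _ H => H.plus) v)

theorem maurerCartan_x : maurerCartan Ψ p (1, 0) =
    lp.single 1 0 (maurerCartan Ψ p (1, 0) 0) + lp.single 1 1 (ξ₁ p 1) := by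
  have minus := mem_loopGroupMinusStar_iff.1 (S.split p hp).minus
  have powers : ξ₁ p ∈ powersIn (Set.Iic 1) :=
    mem_powersIn_Iic.2 (S.potentialX.powers p (S.subset hp))
  have lower := S.maurerCartan_sub_mem_powersIn_Iic hD hp (1, 0)
  have upper := S.maurerCartan_sub_mem_powersIn_Ici hD hp (1, 0)
  rw [one_smul] at lower
  rw [zero_smul, sub_zero] at upper
  have eq_conj {k : ℤ} (hk : 0 ≤ k) :
      maurerCartan Ψ p (1, 0) k = (M p * ξ₁ p * adj (M p)) k :=
    sub_eq_zero.1 (mem_powersIn_Iic.1 lower k (by omega))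
  have mem : maurerCartan Ψ p (1, 0) ∈ powersIn {0, 1} := mem_powersIn.2 fun k hk => by
    simp only [Set.mem_insert_iff, Set.mem_singleton_iff, not_or] at hk
    rcases lt_or_ge k 0 with neg | nonneg
    · exact mem_powersIn_Ici.1 upper k neg
    · rw [eq_conj nonneg]
      exact mem_powersIn_Iic.1 (conj_mem_powersIn_Iic minus.2.1 powers) k (by omega)
  have top : maurerCartan Ψ p (1, 0) 1 = ξ₁ p 1 :=
    (eq_conj zero_le_one).trans (conj_coeff_top minus.2.1 minus.2.2 powers)
  rw [← top]
  exact eq_single_add_single_of_mem_powersIn zero_ne_one mem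

theorem maurerCartan_y : maurerCartan Ψ p (0, 1) =
    lp.single 1 (-1) (maurerCartan Ψ p (0, 1) (-1)) := by
  have plus := mem_loopGroupPlus_iff.1 (S.split p hp).plus
  have lower := S.maurerCartan_sub_mem_powersIn_Iic hD hp (0, 1)
  have upper := S.maurerCartan_sub_mem_powersIn_Ici hD hp (0, 1)
  rw [zero_smul, sub_zero] at lower
  rw [one_smul] at upper
  have conj := conj_mem_powersIn_Ici plus.2
    (mem_powersIn_Ici.2 (S.potentialY.powers p (S.subset hp)))
  have ge : maurerCartan Ψ p (0, 1) ∈ powersIn (Set.Ici (-1)) := by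
    rw [← sub_add_cancel (maurerCartan Ψ p (0, 1)) (N p * ξ₂ p * adj (N p))]
    exact add_mem (powersIn_mono (Set.Ici_subset_Ici.2 (by norm_num)) upper) conj
  refine eq_single_of_mem_powersIn (mem_powersIn.2 fun k hk => ?_)
  rcases lt_or_gt_of_ne hk with lt | gt
  · exact mem_powersIn_Ici.1 ge k lt
  · exact mem_powersIn_Iic.1 lower k gt

theorem maurerCartan_x_zero_mem_kPart : maurerCartan Ψ p (1, 0) 0 ∈ kPart := by
  have alg := maurerCartan_mem_loopAlg ((S.eventually_split hp).mono fun _ H => H.mem)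
    (S.differentiableAt hD hp) (1, 0)
  exact mem_kPart_of_sigma (alg.1 0) (by simpa using alg.2 0)

omit hD in
theorem potentialX_one_mem_mPart : ξ₁ p 1 ∈ mPart :=
  mem_mPart_of_sigma (by simpa using (S.potentialX.mem p (S.subset hp)).2 1)

theorem maurerCartan_y_neg_one_mem_mPart : maurerCartan Ψ p (0, 1) (-1) ∈ mPart := by
  have alg := maurerCartan_mem_loopAlg ((S.eventually_split hp).mono fun _ H => H.mem)
    (S.differentiableAt hD hp) (0, 1)
  exact mem_mPart_of_sigma (by simpa using alg.2 (-1))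

end Form

variable [SimplyConnectedSpace D] (hD : IsOpen D) (S : IsSplitPair D U ξ₁ ξ₂ Ψ₁ Ψ₂ Ψ M N)

include hD S

/-- Dilations with `|t| ≥ 1` are bounded on powers `k ≤ 1`, those with `|t| ≤ 1` on powers
`k ≥ -1`; hence the two expressions `Ψ₁ M⁻¹` and `Ψ₂ N⁻¹` of `Ψ` are both needed. -/
theorem exists_contDiffOn_isDilation (h0 : (0, 0) ∈ D) {t : ℝ} (ht : t ≠ 0) :
    ∃ Φ : ℝ × ℝ → Loop, ContDiffOn ℝ ∞ Φ U ∧ ∀ p ∈ U, IsDilation t (Ψ p) (Φ p) := by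
  rcases le_total 1 |t| with ge | le
  · obtain ⟨Φ, hΦ, dil⟩ := S.frameX.exists_contDiffOn_isDilation hD (e := (1, 0)) rfl h0 ht
      (fun p hp => mem_powersIn_Iic.2 (S.potentialX.powers p hp))
      fun k => abs_zpow_le_of_mem_Iic ge
    obtain ⟨L, hL⟩ := exists_clm_isDilation (A := M2) (S := Set.Iic 0)
      fun k => abs_zpow_le_of_mem_Iic ge
    refine ⟨fun p => Φ p * L (adj (M p)), (hΦ.mono S.subset).mul
      ((L ∘L adj).contDiff.comp_contDiffOn (S.contDiffOn_factors hD).1), fun p hp => ?_⟩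
    rw [(S.split p hp).eq_mul_adj_fst]
    exact (dil p (S.subset hp)).mul ht (hL _ (adj_mem_powersIn
      (mem_loopGroupMinusStar_iff.1 (S.split p hp).minus).2.1))
  · obtain ⟨Φ, hΦ, dil⟩ := S.frameY.exists_contDiffOn_isDilation hD (e := (0, 1)) rfl h0 ht
      (fun p hp => mem_powersIn_Ici.2 (S.potentialY.powers p hp))
      fun k => abs_zpow_le_of_mem_Ici ht le
    obtain ⟨L, hL⟩ := exists_clm_isDilation (A := M2) (S := Set.Ici 0)
      fun k => abs_zpow_le_of_mem_Ici ht le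
    refine ⟨fun p => Φ p * L (adj (N p)), (hΦ.mono S.subset).mul
      ((L ∘L adj).contDiff.comp_contDiffOn (S.contDiffOn_factors hD).2), fun p hp => ?_⟩
    rw [(S.split p hp).eq_mul_adj_snd]
    exact (dil p (S.subset hp)).mul ht (hL _ (adj_mem_powersIn
      (mem_loopGroupPlus_iff.1 (S.split p hp).plus).2))

theorem mem_loopGroupAn (h0 : (0, 0) ∈ D) {p : ℝ × ℝ} (hp : p ∈ U) : Ψ p ∈ loopGroupAn :=
  ⟨(S.split p hp).mem, extendsAnalytically_of_isDilation fun t ht => by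
    obtain ⟨Φ, -, dil⟩ := S.exists_contDiffOn_isDilation hD h0 ht.ne'
    exact ⟨Φ p, dil p hp⟩⟩

theorem isExtendedFraming (h0 : (0, 0) ∈ U) : IsExtendedFraming U Ψ := by
  have smooth (v : ℝ × ℝ) (k : ℤ) : ContDiffOn ℝ ∞ (fun p => maurerCartan Ψ p v k) U :=
    (coeff k).contDiff.comp_contDiffOn (contDiffOn_maurerCartan S.isOpen (S.contDiffOn hD) v)
  have init : Ψ (0, 0) = 1 := by
    have split := S.split _ h0
    rw [S.frameX.init, S.frameY.init] at split
    exact (split.unique .one).1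
  refine ⟨S.contDiffOn hD, fun p => S.mem_loopGroupAn hD (S.subset h0), init,
    fun p => maurerCartan Ψ p (1, 0) 0, fun p => ξ₁ p 1, fun _ => 0,
    fun p => maurerCartan Ψ p (0, 1) (-1), smooth _ _,
    (coeff 1).contDiff.comp_contDiffOn (S.potentialX.smooth.mono S.subset), contDiffOn_const,
    smooth _ _, fun p hp => ⟨S.maurerCartan_x_zero_mem_kPart hD hp, S.potentialX_one_mem_mPart hp,
      kPart.zero_mem, S.maurerCartan_y_neg_one_mem_mPart hD hp⟩,
    fun p hp => (S.differentiableAt hD hp).differentiableWithinAt, fun p hp => ⟨?_, ?_⟩⟩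
  · exact (mul_maurerCartan (S.split p hp).mem _).symm.trans
      (congrArg (Ψ p * ·) (S.maurerCartan_x hD hp))
  · refine (mul_maurerCartan (S.split p hp).mem _).symm.trans
      (congrArg (Ψ p * ·) ((S.maurerCartan_y hD hp).trans ?_))
    exact (add_eq_right.2 (map_zero (lp.singleAddMonoidHom _ 0))).symm

theorem isHarmonicMap (h0 : (0, 0) ∈ D) {t : ℝ} (ht : t ≠ 0) :
    IsHarmonicMap U (fun p => Ad ((Ψ p).evalReal t) matK) := by
  obtain ⟨Φ, hΦ, dil⟩ := S.exists_contDiffOn_isDilation hD h0 ht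
  have deriv {p} (hp : p ∈ U) (v : ℝ × ℝ) : fderiv ℝ (fun q => (Ψ q).evalReal t) p v =
      (Ψ p).evalReal t * (maurerCartan Ψ p v).evalReal t :=
    have hUp := S.isOpen.mem_nhds hp
    fderiv_evalReal ht (S.differentiableAt hD hp)
      ((hΦ.contDiffAt hUp).differentiableAt (by simp)) (Filter.eventually_of_mem hUp dil)
      (S.split p hp).mem v
  have ξ_diff {p} (hp : p ∈ U) : DifferentiableAt ℝ ξ₁ p :=
    (S.potentialX.smooth.contDiffAt (hD.mem_nhds (S.subset hp))).differentiableAt (by simp)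
  refine isHarmonicMap_Ad_matK S.isOpen (A := fun p => maurerCartan Ψ p (1, 0) 0)
    (B := fun p => t • ξ₁ p 1) (E := fun p => t⁻¹ • maurerCartan Ψ p (0, 1) (-1))
    ((total.contDiff.comp_contDiffOn hΦ).congr fun p hp => (dil p hp).evalReal_eq)
    (fun p hp => (dil p hp).det_evalReal ht (S.split p hp).mem) (fun p hp => ?_) (fun p hp => ?_)
    (fun p => S.maurerCartan_x_zero_mem_kPart hD)
    (fun p hp => mPart.smul_mem _ (S.potentialX_one_mem_mPart hp))
    (fun p hp => mPart.smul_mem _ (S.maurerCartan_y_neg_one_mem_mPart hD hp))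
    (fun p hp => ((t • coeff 1).differentiableAt.comp p (ξ_diff hp)).differentiableWithinAt)
    fun p hp => ?_
  · rw [deriv hp, S.maurerCartan_x hD hp, evalReal_single_add_single, zpow_zero, one_smul,
      zpow_one, ← S.maurerCartan_x hD hp]
  · rw [deriv hp, S.maurerCartan_y hD hp, evalReal_single, zpow_neg_one, ← S.maurerCartan_y hD hp]
  · exact (map_fderiv_apply (t • coeff 1) (ξ_diff hp) (.of_forall fun _ => rfl) (0, 1)).symm.trans
      (by rw [S.potentialX.holomorphic p (S.subset hp), map_zero])

end IsSplitPair

theorem exists_splitting_neighbourhood {E : Type*} [NormedAddCommGroup E] [NormedSpace ℝ E]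
    {D : Set E} (hD : IsOpen D) {g h : E → Loop} {p₀ : E} (hp₀ : p₀ ∈ D) {Ψ₀ M₀ N₀ : Loop}
    (H : IsIwasawa (g p₀) (h p₀) Ψ₀ M₀ N₀) (hg : ContinuousAt g p₀) (hh : ContinuousAt h p₀)
    (mem : ∀ p ∈ D, g p ∈ loopGroup ∧ h p ∈ loopGroup) :
    ∃ U : Set E, IsOpen U ∧ IsConnected U ∧ p₀ ∈ U ∧ U ⊆ D ∧
      ∀ p ∈ U, ∃! t : Loop × Loop × Loop, IsIwasawa (g p) (h p) t.1 t.2.1 t.2.2 := by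
  obtain ⟨r, hr, ball⟩ := Metric.eventually_nhds_iff_ball.1
    ((H.eventually_near hg hh).and (hD.mem_nhds hp₀))
  refine ⟨Metric.ball p₀ r, Metric.isOpen_ball,
    (convex_ball p₀ r).isConnected ⟨p₀, Metric.mem_ball_self hr⟩, Metric.mem_ball_self hr,
    fun p hp => (ball p hp).2, fun p hp => ?_⟩
  obtain ⟨near, hpD⟩ := ball p hp
  refine ⟨(_, _, _), H.near (mem p hpD).1 (mem p hpD).2 rfl near, fun t ht => ?_⟩
  obtain ⟨h₁, h₂, h₃⟩ := ht.unique (H.near (mem p hpD).1 (mem p hpD).2 rfl near)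
  exact Prod.ext h₁ (Prod.ext h₂ h₃)

end Timelike

end

theorem theorem4p3_general (D : Set (ℝ × ℝ)) (hD : IsOpen D) (hsc : SimplyConnectedSpace D)
    (h0 : ((0, 0) : ℝ × ℝ) ∈ D) (ξ₁ ξ₂ : ℝ × ℝ → Timelike.Loop)
    (h₁ : Timelike.IsPotentialX D ξ₁) (h₂ : Timelike.IsPotentialY D ξ₂) :
    ∃ Ψ₁ Ψ₂ : ℝ × ℝ → Timelike.Loop,
      Timelike.IsTheSolution D Ψ₁ ξ₁ (fun _ => 0) ∧
      Timelike.IsTheSolution D Ψ₂ (fun _ => 0) ξ₂ ∧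
      (Timelike.AnalyticLoops D ξ₁ → ∀ p ∈ D, Ψ₁ p ∈ Timelike.loopGroupAn) ∧
      (Timelike.AnalyticLoops D ξ₂ → ∀ p ∈ D, Ψ₂ p ∈ Timelike.loopGroupAn) ∧
      (∃ U : Set (ℝ × ℝ), IsOpen U ∧ IsConnected U ∧ ((0, 0) : ℝ × ℝ) ∈ U ∧ U ⊆ D ∧
        ∀ p ∈ U, ∃! t : Timelike.Loop × Timelike.Loop × Timelike.Loop,
          Timelike.IsIwasawa (Ψ₁ p) (Ψ₂ p) t.1 t.2.1 t.2.2) ∧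
      ∀ U : Set (ℝ × ℝ), IsOpen U → ((0, 0) : ℝ × ℝ) ∈ U → U ⊆ D →
        ∀ Ψ M N : ℝ × ℝ → Timelike.Loop,
          (∀ p ∈ U, Timelike.IsIwasawa (Ψ₁ p) (Ψ₂ p) (Ψ p) (M p) (N p)) →
            ContDiffOn ℝ ∞ M U ∧ ContDiffOn ℝ ∞ N U ∧
            Timelike.IsExtendedFraming U Ψ ∧
            (∀ t : ℝ, t ≠ 0 →
              Timelike.IsHarmonicMap U
                (fun p => Timelike.Ad ((Ψ p).evalReal t) Timelike.matK)) ∧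
            (∀ p ∈ U, Ψ₁ p ∈ Timelike.loopGroupAn → M p ∈ Timelike.loopGroupAn) ∧
            (∀ p ∈ U, Ψ₂ p ∈ Timelike.loopGroupAn → N p ∈ Timelike.loopGroupAn) := by
  obtain ⟨Ψ₁, f₁⟩ := (h₁.isChiralPotential hD).exists_isChiralFrame hD (e := (1, 0)) rfl h0
  obtain ⟨Ψ₂, f₂⟩ := (h₂.isChiralPotential hD).exists_isChiralFrame hD (e := (0, 1)) rfl h0
  have split₀ : Timelike.IsIwasawa (Ψ₁ (0, 0)) (Ψ₂ (0, 0))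
      Timelike.Loop.one Timelike.Loop.one Timelike.Loop.one := by
    rw [f₁.init, f₂.init]
    exact .one
  refine ⟨Ψ₁, Ψ₂, f₁.isTheSolution_fst hD h0, f₂.isTheSolution_snd hD h0,
    f₁.mem_loopGroupAn hD (e := (1, 0)) rfl h0,
    f₂.mem_loopGroupAn hD (e := (0, 1)) rfl h0,
    Timelike.exists_splitting_neighbourhood hD h0 split₀
      ((f₁.smooth hD).continuousOn.continuousAt (hD.mem_nhds h0))
      ((f₂.smooth hD).continuousOn.continuousAt (hD.mem_nhds h0))
      fun p hp => ⟨f₁.mem p hp, f₂.mem p hp⟩,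
    fun U hU h0U hUD Ψ M N split => ?_⟩
  have S : Timelike.IsSplitPair D U ξ₁ ξ₂ Ψ₁ Ψ₂ Ψ M N := ⟨hU, hUD, h₁, h₂, f₁, f₂, split⟩
  exact ⟨(S.contDiffOn_factors hD).1, (S.contDiffOn_factors hD).2, S.isExtendedFraming hD h0U,
    fun t ht => S.isHarmonicMap hD h0 ht,
    fun p hp => Timelike.mem_loopGroupAn_of_eq_mul (S.mem_loopGroupAn hD h0 hp)
      (split p hp).minus.1 (split p hp).fst_eq,
    fun p hp => Timelike.mem_loopGroupAn_of_eq_mul (S.mem_loopGroupAn hD h0 hp)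
      (split p hp).plus.1 (split p hp).snd_eq⟩

theorem theorem4p3 (D : Set (ℝ × ℝ)) (hD : IsOpen D) (hsc : SimplyConnectedSpace D)
    (h0 : ((0, 0) : ℝ × ℝ) ∈ D) (ξ₁ ξ₂ : ℝ × ℝ → Timelike.Loop)
    (h₁ : Timelike.IsPotentialX D ξ₁) (h₂ : Timelike.IsPotentialY D ξ₂) :
    ∃ Ψ₁ Ψ₂ : ℝ × ℝ → Timelike.Loop,
      -- the two initial value problems
      Timelike.IsTheSolution D Ψ₁ ξ₁ (fun _ => 0) ∧
      Timelike.IsTheSolution D Ψ₂ (fun _ => 0) ξ₂ ∧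
      -- potentials in the analytic loop algebra have solutions in the analytic loop group
      (Timelike.AnalyticLoops D ξ₁ → ∀ p ∈ D, Ψ₁ p ∈ Timelike.loopGroupAn) ∧
      (Timelike.AnalyticLoops D ξ₂ → ∀ p ∈ D, Ψ₂ p ∈ Timelike.loopGroupAn) ∧
      -- near the origin the pair splits, in a unique way
      (∃ U : Set (ℝ × ℝ), IsOpen U ∧ IsConnected U ∧ ((0, 0) : ℝ × ℝ) ∈ U ∧ U ⊆ D ∧
        ∀ p ∈ U, ∃! t : Timelike.Loop × Timelike.Loop × Timelike.Loop,
          Timelike.IsIwasawa (Ψ₁ p) (Ψ₂ p) t.1 t.2.1 t.2.2) ∧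
      -- wherever it splits, the splitting gives an extended framing and a loop of harmonic maps
      ∀ U : Set (ℝ × ℝ), IsOpen U → IsConnected U → ((0, 0) : ℝ × ℝ) ∈ U → U ⊆ D →
        ∀ Ψ M N : ℝ × ℝ → Timelike.Loop,
          (∀ p ∈ U, Timelike.IsIwasawa (Ψ₁ p) (Ψ₂ p) (Ψ p) (M p) (N p)) →
            ContDiffOn ℝ ∞ M U ∧ ContDiffOn ℝ ∞ N U ∧
            Timelike.IsExtendedFraming U Ψ ∧
            (∀ t : ℝ, 0 < t →
              Timelike.IsHarmonicMap U
                (fun p => Timelike.Ad ((Ψ p).evalReal t) Timelike.matK)) ∧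
            (∀ p ∈ U, Ψ₁ p ∈ Timelike.loopGroupAn → M p ∈ Timelike.loopGroupAn) ∧
            (∀ p ∈ U, Ψ₂ p ∈ Timelike.loopGroupAn → N p ∈ Timelike.loopGroupAn) := by
  obtain ⟨Ψ₁, Ψ₂, hΨ₁, hΨ₂, an₁, an₂, near, split⟩ := theorem4p3_general D hD hsc h0 ξ₁ ξ₂ h₁ h₂
  refine ⟨Ψ₁, Ψ₂, hΨ₁, hΨ₂, an₁, an₂, near, fun U hU _ h0U hUD Ψ M N hs => ?_⟩
  obtain ⟨hM, hN, framing, harmonic, an⟩ := split U hU h0U hUD Ψ M N hs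
  exact ⟨hM, hN, framing, fun t ht => harmonic t ht.ne', an⟩
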